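/- **Setting.** A graphon is a symmetric measurable function $W:[0,1]^2\to[0,1]$; $T_WX(u)=\int_0^1W(u,v)X(v)\,dv$ on $L^2=L^2([0,1])$ (real valued). Let $L,K\ge 0$ be integers, $\sigma:\mathbb R\to\mathbb R$ a $1$-Lipschitz function, and $\mathcal H=\{h_{l,k}\}_{1\le l\le L,\,0\le k<K}$ a fixed (hence bounded) finite family of real weights. The graphon neural network with one feature per layer is $X_0=X\in L^2$, $U_l=\sum_{k<K}h_{l,k}T_W^kX_{l-1}$, $X_l=\sigma(U_l)$, $f(X;W,\mathcal H)=X_L$. Its tangent kernel is the operator on $L^2$ $$\Theta(X,X';W,\mathcal H)=\sum_{l,k}\partial_{h_{l,k}}f(X;W,\mathcal H)\otimes\partial_{h_{l,k}}f(X';W,\mathcal H),\qquad (a\otimes b)Y=a\int_0^1bY,$$ where $\partial_{h_{l,k}}f$ is given by the chain rule: $\partial_{h_{l,k}}X_l=\sigma'(U_l)\,T_W^kX_{l-1}$ and $\partial_{h_{l,k}}X_m=\sigma'(U_m)\sum_{j<K}h_{m,j}T_W^j\,\partial_{h_{l,k}}X_{m-1}$ for $m>l$ (with $\sigma'=0$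 at points where $\sigma$ is not differentiable). For each $n$ let $G_n$ be an undirected graph on $n$ nodes with edge weights $w_n(i,j)=w_n(j,i)\in[0,1]$, and let $x_{1,n},\dots,x_{M,n}\in\mathbb R^n$ be signals on $G_n$. With $I_i=[(i-1)/n,i/n)$ for $i<n$ and $I_n=[(n-1)/n,1]$, the induced graphon is $W_n(u,v)=w_n(i,j)$ for $u\in I_i,\ v\in I_j$, and the induced signals are $X_{i,n}(u)=[x_{i,n}]_j$ for $u\in I_j$. For a permutation $\pi_n$ of the nodes, $W_n^{\pi_n}$ and $X_{i,n}^{\pi_n}$ denote the objects induced after relabelling the nodes of $G_n$ and of all its signals by $\pi_n$. **Theorem.** Let $W$ be a graphon and $X_1,\dots,X_M\in L^2$. Assume that $G_n\to W$ in the sense that all homomorphism densities of finite simple graphs converge, and that $(G_n,x_{i,n})\to(W,X_i)$ for all $i$, up to relabellings $\pi_n$ of the nodes that do not depend on $i$, in the sense that $W_n^{\pi_n}\to W$ in the cut norm and $\|X_{i,n}^{\pi_n}-X_i\|_{L^2}\to0$. Assume moreover that, for every $i$ and every $1\le l\le L$, for almost every $u\in[0,1]$, $\sigma$ is differentiable at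 $U_l(u)$ and $\sigma'$ is continuous at $U_l(u)$, where $U_l$ is computed from $(W,X_i)$ (this always holds if $\sigma$ is continuously differentiable). Define operators on $L^2([0,1])^M$ by $[\Theta_n]_{ij}=\Theta(X_{i,n},X_{j,n};W_n,\mathcal H)$, $[\Theta_n^{\pi}]_{ij}=\Theta(X_{i,n}^{\pi_n},X_{j,n}^{\pi_n};W_n^{\pi_n},\mathcal H)$ and $[\Theta]_{ij}=\Theta(X_i,X_j;W,\mathcal H)$. For a compact self-adjoint operator $T$ let $\lambda_p(T)$, $p\in\mathbb Z\setminus\{0\}$, be its eigenvalues counted with multiplicity, $\lambda_{-1}\le\lambda_{-2}\le\dots\le0\le\dots\le\lambda_2\le\lambda_1$, where the list of positive eigenvalues ($p>0$) and that of negative eigenvalues ($p<0$) are continued by zeros if they are finite. Then all $\Theta_n$, $\Theta_n^\pi$, $\Theta$ are compact and self-adjoint, and: 1. for every $p\ne0$, $\lim_{n\to\infty}|\lambda_p(\Theta_n)-\lambda_p(\Theta)|=0$, and $\lambda_p(\Theta_n^\pi)=\lambda_p(\Theta_n)$ for all $n$; 2. for every $p\neq 0$ with $\lambda_p(\Theta)\neq0$,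 the orthogonal projection onto the span of the eigenspaces of $\Theta_n^\pi$ for the eigenvalues $\lambda_q(\Theta_n^\pi)$, $q\in\{q\ne0:\lambda_q(\Theta)=\lambda_p(\Theta)\}$, converges in operator norm to the orthogonal projection onto the eigenspace of $\Theta$ for $\lambda_p(\Theta)$. (If $\lambda_p(\Theta)$ is simple, these are the projections onto the eigenspaces of the $p$-th eigenvalues.) -/

import Mathlib

open MeasureTheory Filter Topology

noncomputable section

namespace GNTK

/-! ### Graphs, graphons and homomorphism densities -/

/-- An undirected graph on `n` nodes with edge weights `w i j ∈ [0, 1]` (weight `0` means that there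
is no edge; an unweighted graph has weights `0` and `1`). -/
structure WGraph (n : ℕ) where
  w : Fin n → Fin n → ℝ
  symm : ∀ i j, w i j = w j i
  nonneg : ∀ i j, 0 ≤ w i j
  le_one : ∀ i j, w i j ≤ 1

/-- A graphon: a symmetric measurable function `[0,1]² → [0,1]`. -/
structure Graphon where
  toFun : unitInterval → unitInterval → ℝ
  measurable : Measurable (Function.uncurry toFun)
  symm : ∀ u v, toFun u v = toFun v u
  nonneg : ∀ u v, 0 ≤ toFun u v
  le_one : ∀ u v, toFun u v ≤ 1

instance : CoeFun Graphon (fun _ => unitInterval → unitInterval → ℝ) := ⟨Graphon.toFun⟩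

open Classical in
/-- The homomorphism density `t(F, G) = hom(F, G) / n ^ |V(F)|`, where `hom(F, G)` is the
(weighted) number of homomorphisms of `F` into `G`. -/
def WGraph.homDensity {n m : ℕ} (F : SimpleGraph (Fin m)) (G : WGraph n) : ℝ :=
  (∑ φ : Fin m → Fin n, ∏ i, ∏ j, if i < j ∧ F.Adj i j then G.w (φ i) (φ j) else 1) / (n : ℝ) ^ m

open Classical in
/-- The homomorphism density `t(F, W) = ∫ ∏_{ij ∈ E(F)} W(u_i, u_j) du`. -/
def Graphon.homDensity {m : ℕ} (F : SimpleGraph (Fin m)) (W : Graphon) : ℝ :=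
  ∫ u : Fin m → unitInterval, ∏ i, ∏ j, if i < j ∧ F.Adj i j then W (u i) (u j) else 1

/-- `G_n → W`: all homomorphism densities of finite simple graphs converge. -/
def GraphsConverge (G : ∀ n, WGraph n) (W : Graphon) : Prop :=
  ∀ (m : ℕ) (F : SimpleGraph (Fin m)),
    Tendsto (fun n => (G n).homDensity F) atTop (𝓝 (W.homDensity F))

/-- The cut norm of a bounded measurable kernel on `[0,1]²`. -/
def cutNorm (k : unitInterval → unitInterval → ℝ) : ℝ :=
  ⨆ S : {S : Set unitInterval × Set unitInterval // MeasurableSet S.1 ∧ MeasurableSet S.2},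
    |∫ z in S.1.1 ×ˢ S.1.2, k z.1 z.2|

/-! ### Relabelled graphs and induced graphon signals -/

/-- The graph with its nodes relabelled by a permutation. -/
def WGraph.relabel {n : ℕ} (G : WGraph n) (π : Equiv.Perm (Fin n)) : WGraph n where
  w i j := G.w (π i) (π j)
  symm _ _ := G.symm _ _
  nonneg _ _ := G.nonneg _ _
  le_one _ _ := G.le_one _ _

/-- The cells `[i/n, (i+1)/n)` for `i < n - 1`, and `[(n-1)/n, 1]` for `i = n - 1`. -/
def cell (n : ℕ) (i : Fin n) : Set unitInterval :=
  {u | (i : ℝ) / n ≤ u ∧ ((u : ℝ) < ((i : ℝ) + 1) / n ∨ (i : ℕ) + 1 = n)}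

lemma measurableSet_cell (n : ℕ) (i : Fin n) : MeasurableSet (cell n i) := by
  have h1 : Measurable fun u : unitInterval => (u : ℝ) := measurable_subtype_coe
  exact (measurableSet_le measurable_const h1).inter
    ((measurableSet_lt h1 measurable_const).union (MeasurableSet.const _))

lemma cell_disjoint {n : ℕ} {i j : Fin n} {u : unitInterval} (hi : u ∈ cell n i) (hj : u ∈ cell n j) :
    i = j := by
  have hn : (0 : ℝ) < n := by exact_mod_cast (Fin.pos i)
  have key : ∀ a b : Fin n, u ∈ cell n a → u ∈ cell n b → a ≤ b := by
    intro a b ha hb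
    rcases hb.2 with h | h
    · have h2 := lt_of_le_of_lt ha.1 h
      rw [div_lt_div_iff_of_pos_right hn] at h2
      have h3 : (a : ℕ) < (b : ℕ) + 1 := by exact_mod_cast h2
      exact Fin.le_def.2 (by omega)
    · exact Fin.le_def.2 (by have := a.2; omega)
  exact le_antisymm (key i j hi hj) (key j i hj hi)

open Classical in
/-- The graphon induced by a graph, `W_n(u, v) = ∑ i j, w i j 𝟙(u ∈ I_i) 𝟙(v ∈ I_j)`. -/
def WGraph.inducedGraphon {n : ℕ} (G : WGraph n) : Graphon where
  toFun u v := ∑ i, ∑ j, if u ∈ cell n i ∧ v ∈ cell n j then G.w i j else 0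
  measurable := by
    refine Finset.measurable_fun_sum _ fun i _ => Finset.measurable_fun_sum _ fun j _ => ?_
    exact Measurable.ite (((measurableSet_cell n i).preimage measurable_fst).inter
      ((measurableSet_cell n j).preimage measurable_snd)) measurable_const measurable_const
  symm u v := by
    rw [Finset.sum_comm]
    refine Finset.sum_congr rfl fun i _ => Finset.sum_congr rfl fun j _ => ?_
    rw [G.symm j i]
    simp only [and_comm]
  nonneg u v := Finset.sum_nonneg fun i _ => Finset.sum_nonneg fun j _ => by
    split_ifs
    · exact G.nonneg i j
    · exact le_rfl
  le_one u v := by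
    by_cases h : ∃ a b, u ∈ cell n a ∧ v ∈ cell n b
    · obtain ⟨a, b, ha, hb⟩ := h
      rw [Finset.sum_eq_single a, Finset.sum_eq_single b]
      · rw [if_pos ⟨ha, hb⟩]
        exact G.le_one a b
      · intro j _ hj
        exact if_neg fun h => hj (cell_disjoint h.2 hb)
      · simp
      · intro i _ hi
        exact Finset.sum_eq_zero fun j _ => if_neg fun h => hi (cell_disjoint h.1 ha)
      · simp
    · rw [Finset.sum_eq_zero]
      · exact zero_le_one
      · intro i _
        exact Finset.sum_eq_zero fun j _ => if_neg fun h' => h ⟨i, j, h'⟩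

/-- Graphon signals: the Hilbert space `L²([0,1])`. -/
abbrev Signal : Type := Lp ℝ 2 (volume : Measure unitInterval)

open Classical in
lemma memLp_inducedSignal {n : ℕ} (x : Fin n → ℝ) :
    MemLp (fun u : unitInterval => ∑ i, if u ∈ cell n i then x i else 0) 2 volume := by
  refine memLp_finsetSum _ fun i _ => ?_
  have h : (fun u : unitInterval => if u ∈ cell n i then x i else 0)
      = (cell n i).indicator (fun _ => x i) := by
    ext u
    simp [Set.indicator_apply]
  rw [h]
  exact (memLp_const (x i)).indicator (measurableSet_cell n i)

/-- The graphon signal induced by a graph signal, `X_n(u) = ∑ i, x i 𝟙(u ∈ I_i)`. -/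
def inducedSignal {n : ℕ} (x : Fin n → ℝ) : Signal := (memLp_inducedSignal x).toLp _

/-! ### Graphon neural networks (one feature per layer) -/

lemma integral_abs_le_norm (X : Signal) : ∫ v, |X v| ≤ ‖X‖ := by
  have h1 : eLpNorm X 1 volume ≤ eLpNorm X 2 volume :=
    eLpNorm_le_eLpNorm_of_exponent_le (by norm_num) (Lp.aestronglyMeasurable X)
  have h2 : ∫ v, |X v| = (eLpNorm X 1 volume).toReal := by
    rw [eLpNorm_one_eq_lintegral_enorm, ← integral_norm_eq_lintegral_enorm
      (Lp.aestronglyMeasurable X)]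
    rfl
  rw [h2, Lp.norm_def]
  exact ENNReal.toReal_mono (Lp.eLpNorm_ne_top X) h1

lemma signal_integrable (X : Signal) : Integrable X volume :=
  (Lp.memLp X).integrable (by norm_num)

lemma Graphon.integrable_mul (W : Graphon) (X : Signal) (u : unitInterval) :
    Integrable (fun v => W u v * X v) volume := by
  refine (signal_integrable X).bdd_mul (c := 1)
    (W.measurable.comp measurable_prodMk_left).aestronglyMeasurable ?_
  exact Eventually.of_forall fun v => by
    change ‖W u v‖ ≤ 1
    rw [Real.norm_of_nonneg (W.nonneg u v)]
    exact W.le_one u v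

lemma Graphon.abs_integral_le (W : Graphon) (X : Signal) (u : unitInterval) :
    ‖∫ v, W u v * X v‖ ≤ ‖X‖ := by
  refine (norm_integral_le_integral_norm _).trans (le_trans ?_ (integral_abs_le_norm X))
  refine integral_mono (W.integrable_mul X u).norm (signal_integrable X).norm fun v => ?_
  simp only [norm_mul, Real.norm_eq_abs]
  rw [abs_of_nonneg (W.nonneg u v)]
  exact mul_le_of_le_one_left (abs_nonneg _) (W.le_one u v)

lemma Graphon.memLp_integral (W : Graphon) (X : Signal) :
    MemLp (fun u => ∫ v, W u v * X v) 2 volume := by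
  refine MemLp.of_bound ?_ ‖X‖ (Eventually.of_forall (W.abs_integral_le X))
  refine StronglyMeasurable.aestronglyMeasurable ?_
  refine StronglyMeasurable.integral_prod_right (f := fun u v => W u v * X v) ?_
  exact (W.measurable.stronglyMeasurable).mul
    ((Lp.stronglyMeasurable X).comp_measurable measurable_snd)

/-- The function `u ↦ ∫₀¹ W(u, v) X(v) dv` as an element of `L²([0,1])`. -/
def Graphon.opFun (W : Graphon) (X : Signal) : Signal := (W.memLp_integral X).toLp _

lemma Graphon.opFun_ae (W : Graphon) (X : Signal) :
    ∀ᵐ u, W.opFun X u = ∫ v, W u v * X v :=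
  (W.memLp_integral X).coeFn_toLp

/-- The graphon operator `(T_W X)(u) = ∫₀¹ W(u, v) X(v) dv` on `L²([0,1])`. -/
def Graphon.op (W : Graphon) : Signal →L[ℝ] Signal :=
  LinearMap.mkContinuous
    { toFun := W.opFun
      map_add' := fun X Y => by
        rw [Graphon.opFun, Graphon.opFun, Graphon.opFun, ← MemLp.toLp_add]
        refine MemLp.toLp_congr _ _ (Eventually.of_forall fun u => ?_)
        simp only [Pi.add_apply]
        rw [← integral_add (W.integrable_mul X u) (W.integrable_mul Y u)]
        refine integral_congr_ae ?_
        filter_upwards [Lp.coeFn_add X Y] with v hv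
        rw [hv, Pi.add_apply, mul_add]
      map_smul' := fun c X => by
        rw [RingHom.id_apply, Graphon.opFun, Graphon.opFun, ← MemLp.toLp_const_smul]
        refine MemLp.toLp_congr _ _ (Eventually.of_forall fun u => ?_)
        simp only [Pi.smul_apply, smul_eq_mul]
        rw [← integral_const_mul]
        refine integral_congr_ae ?_
        filter_upwards [Lp.coeFn_smul c X] with v hv
        rw [hv, Pi.smul_apply, smul_eq_mul]
        ring }
    1
    (fun X => by
      have h : ∀ᵐ u : unitInterval, ‖W.opFun X u‖ ≤ ‖X‖ := by
        filter_upwards [W.opFun_ae X] with u hu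
        rw [hu]
        exact W.abs_integral_le X u
      have := Lp.norm_le_of_ae_bound (norm_nonneg X) h
      have h1 : measureUnivNNReal (volume : Measure unitInterval) = 1 := by simp [measureUnivNNReal]
      rw [h1] at this
      simpa using this)

lemma Graphon.op_apply (W : Graphon) (X : Signal) : W.op X = W.opFun X := rfl

/-- The graphon convolution `T_H X = ∑_{k < K} h_k T_W^k X`. -/
def conv (K : ℕ) (c : ℕ → ℝ) (W : Graphon) : Signal →L[ℝ] Signal :=
  ∑ k ∈ Finset.range K, c k • W.op ^ k

lemma memLp_activation {σ : ℝ → ℝ} (hσ : LipschitzWith 1 σ) (U : Signal) :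
    MemLp (fun u => σ (U u)) 2 volume := by
  have h1 : MemLp (fun u => |σ 0| + ‖U u‖) 2 (volume : Measure unitInterval) :=
    MemLp.add (f := fun _ => |σ 0|) (g := fun u => ‖U u‖) (memLp_const _) (Lp.memLp U).norm
  refine h1.mono (hσ.continuous.comp_aestronglyMeasurable (Lp.aestronglyMeasurable U)) ?_
  refine Eventually.of_forall fun u => ?_
  have h2 : |σ (U u) - σ 0| ≤ |U u| := by
    have := hσ.dist_le_mul (U u) 0
    simpa [Real.dist_eq] using this
  rw [Real.norm_of_nonneg (add_nonneg (abs_nonneg _) (norm_nonneg _)), Real.norm_eq_abs,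
    Real.norm_eq_abs]
  calc |σ (U u)| = |σ 0 + (σ (U u) - σ 0)| := by ring_nf
    _ ≤ |σ 0| + |σ (U u) - σ 0| := abs_add_le _ _
    _ ≤ |σ 0| + |U u| := by linarith

/-- The pointwise nonlinearity `σ(U)`. -/
def activation {σ : ℝ → ℝ} (hσ : LipschitzWith 1 σ) (U : Signal) : Signal :=
  (memLp_activation hσ U).toLp _

lemma memLp_deriv_mul {σ : ℝ → ℝ} (hσ : LipschitzWith 1 σ) (U V : Signal) :
    MemLp (fun u => deriv σ (U u) * V u) 2 volume := by
  refine (Lp.memLp V).mono ?_ ?_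
  · exact ((measurable_deriv σ).comp_aemeasurable
      (Lp.aestronglyMeasurable U).aemeasurable).aestronglyMeasurable.mul
        (Lp.aestronglyMeasurable V)
  · refine Eventually.of_forall fun u => ?_
    have h := norm_deriv_le_of_lipschitz hσ (x₀ := U u)
    rw [norm_mul]
    exact mul_le_of_le_one_left (norm_nonneg _) (by simpa using h)

/-- The pointwise product `σ'(U) V`. -/
def derivMul {σ : ℝ → ℝ} (hσ : LipschitzWith 1 σ) (U V : Signal) : Signal :=
  (memLp_deriv_mul hσ U V).toLp _

/-- The layer outputs of the graphon neural network with `h l k` the `k`-th weight (`k < K`) of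
layer `l ≥ 1`: `X_0 = X` and `X_l = σ(T_{H_l} X_{l-1})`. -/
def layer {σ : ℝ → ℝ} (hσ : LipschitzWith 1 σ) (K : ℕ) (h : ℕ → ℕ → ℝ) (W : Graphon)
    (X : Signal) : ℕ → Signal
  | 0 => X
  | l + 1 => activation hσ (conv K (h (l + 1)) W (layer hσ K h W X l))

/-- The pre-activations `U_l = T_{H_l} X_{l-1}`, for `l ≥ 1`. -/
def preact {σ : ℝ → ℝ} (hσ : LipschitzWith 1 σ) (K : ℕ) (h : ℕ → ℕ → ℝ) (W : Graphon)
    (X : Signal) (l : ℕ) : Signal :=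
  conv K (h l) W (layer hσ K h W X (l - 1))

/-- The partial derivative of the layer output `X_m` in the weight `h l k`, for `l ≥ 1` and `k < K`:
it is `σ'(U_l) T_W^k X_{l-1}` for `m = l`, and `σ'(U_m) T_{H_m} (∂X_{m-1})` for `m > l`.
That this is the derivative in `L²([0,1])` is `hasDerivAt_layer` below. -/
def layerDeriv {σ : ℝ → ℝ} (hσ : LipschitzWith 1 σ) (K : ℕ) (h : ℕ → ℕ → ℝ) (W : Graphon)
    (X : Signal) (l k : ℕ) : ℕ → Signal
  | 0 => 0
  | m + 1 =>
    derivMul hσ (preact hσ K h W X (m + 1))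
      (if m + 1 = l then (W.op ^ k) (layer hσ K h W X m)
        else conv K (h (m + 1)) W (layerDeriv hσ K h W X l k m))

/-- The neural tangent kernel of the `L`-layer graphon neural network `f = X_L`: the operator
`Θ(X, X') = ∑_{l,k} ∂_{h_{l,k}} f(X) ⊗ ∂_{h_{l,k}} f(X')` on `L²([0,1])`, with
`(a ⊗ b) Y = a ∫₀¹ b(v) Y(v) dv`. -/
def wntk {σ : ℝ → ℝ} (hσ : LipschitzWith 1 σ) (L K : ℕ) (h : ℕ → ℕ → ℝ) (W : Graphon)
    (X X' : Signal) : Signal →L[ℝ] Signal :=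
  ∑ l ∈ Finset.Icc 1 L, ∑ k ∈ Finset.range K,
    InnerProductSpace.rankOne ℝ (layerDeriv hσ K h W X l k L) (layerDeriv hσ K h W X' l k L)

/-- The Hilbert space `L²([0,1])^M`. -/
abbrev Signals (M : ℕ) : Type := PiLp 2 (fun _ : Fin M => Signal)

/-- The operator on `L²([0,1])^M` with the given matrix entries: `(A Y)_i = ∑_j A_{ij} Y_j`. -/
def blockOp {M : ℕ} (A : Fin M → Fin M → Signal →L[ℝ] Signal) : Signals M →L[ℝ] Signals M :=
  ((PiLp.continuousLinearEquiv 2 ℝ (fun _ : Fin M => Signal)).symm :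
      (Fin M → Signal) →L[ℝ] Signals M) ∘L
    ContinuousLinearMap.pi fun i =>
      ∑ j, A i j ∘L PiLp.proj (𝕜 := ℝ) 2 (fun _ : Fin M => Signal) j

/-- The matrix operator `[Θ(X_i, X_j; W, H)]_{ij}` on `L²([0,1])^M`. -/
def ntkMatrix {σ : ℝ → ℝ} (hσ : LipschitzWith 1 σ) (L K : ℕ) (h : ℕ → ℕ → ℝ) (W : Graphon)
    {M : ℕ} (X : Fin M → Signal) : Signals M →L[ℝ] Signals M :=
  blockOp fun i j => wntk hσ L K h W (X i) (X j)

/-! ### Ordered eigenvalues and spectral projectors of compact self-adjoint operators -/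

section Spectral

variable {E : Type*} [NormedAddCommGroup E] [InnerProductSpace ℝ E]

/-- The eigenspace of `T` for `μ` (`⊥` if `μ` is not an eigenvalue). -/
def eigSpace (T : E →L[ℝ] E) (μ : ℝ) : Submodule ℝ E :=
  Module.End.eigenspace (T : E →ₗ[ℝ] E) μ

/-- The `p`-th largest positive eigenvalue (`p ≥ 1`) of a compact self-adjoint operator, counted
with multiplicity: the largest eigenvalue `μ > 0` such that at least `p` eigenvalues are `≥ μ`.
It is `0` if `T` has fewer than `p` positive eigenvalues. -/
def posEig (T : E →L[ℝ] E) (p : ℕ) : ℝ :=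
  sSup {μ : ℝ | 0 < μ ∧ eigSpace T μ ≠ ⊥ ∧
    p ≤ Module.finrank ℝ (⨆ ν ∈ Set.Ici μ, eigSpace T ν : Submodule ℝ E)}

/-- The eigenvalues `λ_p(T)`, `p ∈ ℤ \ {0}`, of a compact self-adjoint operator, counted with
multiplicity, with `λ_{-1} ≤ λ_{-2} ≤ … ≤ 0 ≤ … ≤ λ_2 ≤ λ_1`: the positive eigenvalues have
positive indices, the negative ones negative indices, and a list that is finite is continued by
zeros. -/
def eig (T : E →L[ℝ] E) (p : ℤ) : ℝ :=
  if 0 < p then posEig T p.toNat else -posEig (-T) (-p).toNat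

/-- The spectral projector of a compact self-adjoint operator for a set `S` of real numbers: the
orthogonal projection onto the closed span of all eigenspaces with eigenvalues in `S`. -/
def spectralProj [CompleteSpace E] (T : E →L[ℝ] E) (S : Set ℝ) : E →L[ℝ] E :=
  (⨆ μ ∈ S, eigSpace T μ).topologicalClosure.starProjection

end Spectral

/-! ### The derivative of the network in its weights -/

lemma norm_activation_sub_le {σ : ℝ → ℝ} (hσ : LipschitzWith 1 σ) (U V : Signal) :
    ‖activation hσ U - activation hσ V‖ ≤ ‖U - V‖ := by
  refine Lp.norm_le_norm_of_ae_le ?_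
  filter_upwards [Lp.coeFn_sub (activation hσ U) (activation hσ V), Lp.coeFn_sub U V,
    (memLp_activation hσ U).coeFn_toLp, (memLp_activation hσ V).coeFn_toLp] with u h1 h2 h3 h4
  rw [h1, h2, Pi.sub_apply, Pi.sub_apply, activation, activation, h3, h4]
  have := hσ.dist_le_mul (U u) (V u)
  simpa [Real.dist_eq] using this

/-- The chain rule for the pointwise nonlinearity in `L²([0,1])`. -/
lemma hasDerivAt_activation {σ : ℝ → ℝ} (hσ : LipschitzWith 1 σ) {g : ℝ → Signal} {v : Signal}
    {t₀ : ℝ} (hg : HasDerivAt g v t₀) (hd : ∀ᵐ u, DifferentiableAt ℝ σ (g t₀ u)) :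
    HasDerivAt (fun t => activation hσ (g t)) (derivMul hσ (g t₀) v) t₀ := by
  rw [hasDerivAt_iff_tendsto_slope_zero] at hg ⊢
  set F : ℝ → Signal := fun s =>
    s⁻¹ • (activation hσ (g t₀ + s • v) - activation hσ (g t₀)) - derivMul hσ (g t₀) v with hF
  have key : Tendsto F (𝓝[≠] 0) (𝓝 0) := by
    have hae : ∀ s : ℝ, ∀ᵐ u, F s u
        = s⁻¹ * (σ (g t₀ u + s * v u) - σ (g t₀ u)) - deriv σ (g t₀ u) * v u := by
      intro s
      filter_upwards [Lp.coeFn_sub (s⁻¹ • (activation hσ (g t₀ + s • v) - activation hσ (g t₀)))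
          (derivMul hσ (g t₀) v),
        Lp.coeFn_smul s⁻¹ (activation hσ (g t₀ + s • v) - activation hσ (g t₀)),
        Lp.coeFn_sub (activation hσ (g t₀ + s • v)) (activation hσ (g t₀)),
        (memLp_activation hσ (g t₀ + s • v)).coeFn_toLp, (memLp_activation hσ (g t₀)).coeFn_toLp,
        (memLp_deriv_mul hσ (g t₀) v).coeFn_toLp, Lp.coeFn_add (g t₀) (s • v),
        Lp.coeFn_smul s v] with u h1 h2 h3 h4 h5 h6 h7 h8
      rw [hF]
      simp only [activation, derivMul] at *
      rw [h1, Pi.sub_apply, h2, Pi.smul_apply, h3, Pi.sub_apply, h4, h5, h6, h7, Pi.add_apply, h8,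
        Pi.smul_apply, smul_eq_mul, smul_eq_mul]
    have hsq : ∀ f : Signal, ‖f‖ ^ 2 = ∫ u, f u * f u := by
      intro f
      rw [← real_inner_self_eq_norm_sq, L2.inner_def]
      rfl
    have hvv : Integrable (fun u => v u * v u) volume :=
      (Lp.memLp v).integrable_mul (Lp.memLp v)
    set Φ : ℝ → unitInterval → ℝ := fun s u =>
      s⁻¹ * (σ (g t₀ u + s * v u) - σ (g t₀ u)) - deriv σ (g t₀ u) * v u with hΦ
    have hFΦ : ∀ s, ‖F s‖ ^ 2 = ∫ u, Φ s u * Φ s u := by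
      intro s
      rw [hsq]
      refine integral_congr_ae ?_
      filter_upwards [hae s] with u hu
      rw [hu]
    have hlim : Tendsto (fun s => ∫ u, Φ s u * Φ s u) (𝓝[≠] 0)
        (𝓝 (∫ _ : unitInterval, (0 : ℝ))) := by
      refine tendsto_integral_filter_of_dominated_convergence (fun u => 4 * (v u * v u)) ?_ ?_
        (hvv.const_mul 4) ?_
      · refine Eventually.of_forall fun s => ?_
        have h1 : AEStronglyMeasurable (Φ s) volume :=
          (Lp.aestronglyMeasurable (F s)).congr (hae s)
        exact h1.mul h1
      · filter_upwards [self_mem_nhdsWithin] with s hs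
        have hs0 : s ≠ 0 := hs
        refine Eventually.of_forall fun u => ?_
        have h1 : |s⁻¹ * (σ (g t₀ u + s * v u) - σ (g t₀ u))| ≤ |v u| := by
          have h2 : |σ (g t₀ u + s * v u) - σ (g t₀ u)| ≤ |s * v u| := by
            have := hσ.dist_le_mul (g t₀ u + s * v u) (g t₀ u)
            simpa [Real.dist_eq] using this
          rw [abs_mul, abs_inv, inv_mul_le_iff₀ (abs_pos.2 hs0), ← abs_mul]
          exact h2
        have h3 : |deriv σ (g t₀ u) * v u| ≤ |v u| := by
          have h4 := norm_deriv_le_of_lipschitz hσ (x₀ := g t₀ u)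
          rw [abs_mul]
          exact mul_le_of_le_one_left (abs_nonneg _) (by simpa using h4)
        have h5 : |Φ s u| ≤ 2 * |v u| := (abs_sub _ _).trans (by linarith)
        rw [Real.norm_eq_abs, abs_mul]
        nlinarith [abs_nonneg (Φ s u), abs_nonneg (v u), abs_mul_abs_self (v u)]
      · filter_upwards [hd] with u hu
        have h1 : HasDerivAt (fun s : ℝ => σ (g t₀ u + s * v u)) (deriv σ (g t₀ u) * v u) 0 := by
          have h2 : HasDerivAt (fun s : ℝ => g t₀ u + s * v u) (v u) 0 := by
            simpa using ((hasDerivAt_id (0 : ℝ)).mul_const (v u)).const_add (g t₀ u)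
          have h3 : HasDerivAt σ (deriv σ (g t₀ u)) (g t₀ u + 0 * v u) := by
            simpa using hu.hasDerivAt
          exact h3.comp (0 : ℝ) h2
        rw [hasDerivAt_iff_tendsto_slope_zero] at h1
        have h4 : Tendsto (fun s => Φ s u) (𝓝[≠] 0) (𝓝 0) := by
          have h5 := h1.sub_const (deriv σ (g t₀ u) * v u)
          simpa [hΦ] using h5
        simpa using h4.mul h4
    simp only [integral_zero] at hlim
    simp only [← hFΦ] at hlim
    rw [tendsto_zero_iff_norm_tendsto_zero]
    have h6 := hlim.sqrt
    simpa [Real.sqrt_sq (norm_nonneg _)] using h6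
  have hrem : Tendsto (fun s : ℝ =>
      s⁻¹ • (activation hσ (g (t₀ + s)) - activation hσ (g t₀ + s • v))) (𝓝[≠] 0) (𝓝 0) := by
    have h1 : Tendsto (fun s : ℝ => ‖s⁻¹ • (g (t₀ + s) - g t₀) - v‖) (𝓝[≠] 0) (𝓝 0) := by
      rw [← tendsto_iff_norm_sub_tendsto_zero]
      exact hg
    refine squeeze_zero_norm' ?_ h1
    filter_upwards [self_mem_nhdsWithin] with s hs
    have hs0 : s ≠ 0 := hs
    have h2 : s⁻¹ • (g (t₀ + s) - g t₀) - v = s⁻¹ • (g (t₀ + s) - (g t₀ + s • v)) := by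
      rw [← sub_sub, smul_sub s⁻¹ (g (t₀ + s) - g t₀), inv_smul_smul₀ hs0]
    rw [h2, norm_smul, norm_smul]
    exact mul_le_mul_of_nonneg_left (norm_activation_sub_le hσ _ _) (norm_nonneg _)
  have h7 := (hrem.add key).add_const (derivMul hσ (g t₀) v)
  rw [add_zero, zero_add] at h7
  refine h7.congr fun s => ?_
  rw [hF]
  simp only [smul_sub]
  abel

lemma layer_update_of_lt {σ : ℝ → ℝ} (hσ : LipschitzWith 1 σ) (K : ℕ) (h : ℕ → ℕ → ℝ) (W : Graphon)
    (X : Signal) {l : ℕ} (c : ℕ → ℝ) (m : ℕ) (hm : m < l) :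
    layer hσ K (Function.update h l c) W X m = layer hσ K h W X m := by
  induction m with
  | zero => rfl
  | succ m ih =>
    rw [layer, layer, ih (by omega), Function.update_of_ne (by omega)]

lemma conv_update {K k : ℕ} (hk : k < K) (c : ℕ → ℝ) (W : Graphon) (Z : Signal) (t : ℝ) :
    conv K (Function.update c k t) W Z = conv K c W Z + (t - c k) • (W.op ^ k) Z := by
  have h1 : ∀ j, Function.update c k t j • W.op ^ j
      = c j • W.op ^ j + (if j = k then (t - c k) • W.op ^ k else 0) := by
    intro j
    by_cases hj : j = k
    · subst hj
      simp [← add_smul]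
    · simp [hj]
  simp only [conv, h1, Finset.sum_add_distrib, Finset.sum_ite_eq', Finset.mem_range, hk, if_true]
  rfl

/-- `layerDeriv` is the partial derivative, in `L²([0,1])`, of the layer output in the weight
`h l k`, whenever the activation is differentiable at almost all values it is applied to. -/
theorem hasDerivAt_layer {σ : ℝ → ℝ} (hσ : LipschitzWith 1 σ) {K : ℕ} (h : ℕ → ℕ → ℝ)
    (W : Graphon) (X : Signal) {l k : ℕ} (hk : k < K) (m : ℕ)
    (hd : ∀ j ∈ Finset.Icc 1 m, ∀ᵐ u, DifferentiableAt ℝ σ (preact hσ K h W X j u)) :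
    HasDerivAt (fun t => layer hσ K (Function.update h l (Function.update (h l) k t)) W X m)
      (layerDeriv hσ K h W X l k m) (h l k) := by
  induction m with
  | zero => exact hasDerivAt_const _ _
  | succ m ih =>
    have ih' := ih fun j hj => hd j (Finset.mem_Icc.2
      ⟨(Finset.mem_Icc.1 hj).1, (Finset.mem_Icc.1 hj).2.trans (Nat.le_succ m)⟩)
    have hself : Function.update h l (Function.update (h l) k (h l k)) = h := by simp
    have hpre := hd (m + 1) (Finset.mem_Icc.2 ⟨by omega, le_rfl⟩)
    simp only [layer, layerDeriv]
    set g : ℝ → Signal := fun t =>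
      conv K (Function.update h l (Function.update (h l) k t) (m + 1)) W
        (layer hσ K (Function.update h l (Function.update (h l) k t)) W X m) with hg
    have hg0 : g (h l k) = preact hσ K h W X (m + 1) := by
      rw [hg]
      simp only [hself]
      rfl
    rw [← hg0] at hpre ⊢
    refine hasDerivAt_activation hσ ?_ hpre
    by_cases hl : m + 1 = l
    · subst hl
      rw [if_pos rfl]
      have h2 : g = fun t => conv K (h (m + 1)) W (layer hσ K h W X m)
          + (t - h (m + 1) k) • (W.op ^ k) (layer hσ K h W X m) := by
        funext t
        rw [hg]
        simp only [Function.update_self]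
        rw [layer_update_of_lt hσ K h W X _ m (Nat.lt_succ_self m), conv_update hk]
      change HasDerivAt g _ _
      rw [h2]
      have h3 := (((hasDerivAt_id (h (m + 1) k)).sub_const (h (m + 1) k)).smul_const
        ((W.op ^ k) (layer hσ K h W X m))).const_add (conv K (h (m + 1)) W (layer hσ K h W X m))
      simpa using h3
    · rw [if_neg hl]
      have h2 : g = fun t => conv K (h (m + 1)) W
          (layer hσ K (Function.update h l (Function.update (h l) k t)) W X m) := by
        funext t
        rw [hg]
        simp only [Function.update_of_ne hl]
      change HasDerivAt g _ _
      rw [h2]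
      exact (conv K (h (m + 1)) W).hasFDerivAt.comp_hasDerivAt _ ih'

end GNTK

end

open GNTK

/-! The matrix kernel is `∑ a, v a ⊗ v a`, where `a` runs over the finite set of weights and `v a`
is the vector in `L²([0,1])^M` of derivatives of the `M` outputs in the weight `a`
(`ntkMatrix_eq_sum`). It is therefore positive of finite rank, which gives compactness and
self-adjointness and makes all eigenvalues of negative index zero.

Because the number of weights is fixed, operator norm convergence of the kernels only needs norm
convergence of each `v a`, and for this strong convergence of the graphon operators is enough.
Convergence in the cut norm gives strong convergence: test on indicator functions, then use density
and the bound `‖T_W‖ ≤ 1` (`tendsto_op_apply`). It passes through filters and activations by uniform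
Lipschitz bounds, and through the multiplications by `σ'` by dominated convergence along almost
everywhere convergent subsequences (`tendsto_derivMul_left`); only here is continuity of `σ'` at the
limit pre-activations used.

Norm convergence then yields the spectral claims: Weyl's inequality for the eigenvalues
(`PosDiag.abs_eig_sub_le`), and a spectral gap estimate of Davis–Kahan type for the projectors
(`PosDiag.norm_spectralProj_sub_le`).

Relabelling does not change the eigenvalues: it permutes the values of all derivative step
functions, hence preserves the Gram matrix of the `v a`, and this matrix determines the positive
spectrum of `∑ a, v a ⊗ v a` (`posEig_eq_of_gram_eq`, `eig_ntkMatrix_relabel`). -/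

open MeasureTheory Filter Topology

noncomputable section

namespace GNTK

/-! ### Positive operators of finite rank: diagonalisation and ordered eigenvalues. -/

section Spectral

variable {E : Type*} [NormedAddCommGroup E] [InnerProductSpace ℝ E]

/-- `T = ∑ i, l i • (e i ⊗ e i)` with `e` orthonormal and all `l i` positive. -/
structure PosDiag (T : E →L[ℝ] E) {N : ℕ} (e : Fin N → E) (l : Fin N → ℝ) : Prop where
  orthonormal : Orthonormal ℝ e
  pos : ∀ i, 0 < l i
  apply : ∀ x, T x = ∑ i, (l i * inner ℝ (e i) x) • e i

/-- The finite-dimensional range is invariant, so the spectral theorem applies there. Zero cannot be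
an eigenvalue on the range: if `b = T y` and `T b = 0`, then `⟪b, b⟫ = ⟪T b, y⟫ = 0`. Expanding `T
x` in the eigenbasis of the range and moving `T` across the inner product gives the formula on all
of `E`. -/
lemma exists_posDiag (T : E →L[ℝ] E) (hT : (T : E →ₗ[ℝ] E).IsSymmetric)
    (hfin : FiniteDimensional ℝ (T : E →ₗ[ℝ] E).range) (hpos : ∀ x, 0 ≤ inner ℝ (T x) x) :
    ∃ (N : ℕ) (e : Fin N → E) (l : Fin N → ℝ), PosDiag T e l := by
  have hinv : ∀ v ∈ (T : E →ₗ[ℝ] E).range, (T : E →ₗ[ℝ] E) v ∈ (T : E →ₗ[ℝ] E).range :=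
    fun v _ => LinearMap.mem_range_self _ v
  have hS := hT.restrict_invariant hinv
  set b := hS.eigenvectorBasis rfl with hb
  set l := hS.eigenvalues rfl with hl
  have hTe : ∀ i, T (b i : E) = l i • (b i : E) := fun i => by
    have := congrArg Subtype.val (hS.apply_eigenvectorBasis rfl i)
    exact this
  have ho : Orthonormal ℝ fun i => (b i : E) :=
    b.orthonormal.comp_linearIsometry (Submodule.subtypeₗᵢ _)
  have hee : ∀ i, inner ℝ (b i : E) (b i : E) = (1 : ℝ) := fun i => by
    rw [real_inner_self_eq_norm_sq, ho.1 i]; norm_num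
  refine ⟨_, fun i => (b i : E), l, ho, fun i => ?_, fun x => ?_⟩
  · have h1 : 0 ≤ l i := by
      have := hpos (b i : E)
      rwa [hTe, inner_smul_left, hee, mul_one] at this
    refine lt_of_le_of_ne h1 fun h0 => ?_
    obtain ⟨y, hy⟩ := (b i).2
    have h2 := hT (b i : E) y
    rw [hy] at h2
    change inner ℝ (T (b i : E)) y = _ at h2
    rw [hTe, ← h0, zero_smul, inner_zero_left, hee] at h2
    exact zero_ne_one h2
  · have h := congrArg Subtype.val
      (b.sum_repr' (⟨T x, LinearMap.mem_range_self _ x⟩ : (T : E →ₗ[ℝ] E).range))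
    simp only [Submodule.coe_sum, Submodule.coe_smul, Submodule.coe_inner] at h
    rw [← h]
    refine Finset.sum_congr rfl fun i _ => ?_
    congr 1
    have h2 : inner ℝ (T (b i : E)) x = inner ℝ (b i : E) (T x) := hT (b i : E) x
    rw [← h2, hTe, inner_smul_left]
    rfl

namespace PosDiag

variable {T : E →L[ℝ] E} {N : ℕ} {e : Fin N → E} {l : Fin N → ℝ}

lemma apply_basis (h : PosDiag T e l) (i : Fin N) : T (e i) = l i • e i := by
  classical
  rw [h.apply]
  simp [orthonormal_iff_ite.1 h.orthonormal]

lemma inner_apply (h : PosDiag T e l) (i : Fin N) (x : E) :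
    inner ℝ (e i) (T x) = l i * inner ℝ (e i) x := by
  classical
  rw [h.apply, inner_sum]
  simp [inner_smul_right, orthonormal_iff_ite.1 h.orthonormal]

lemma inner_apply_self (h : PosDiag T e l) (x : E) :
    inner ℝ (T x) x = ∑ i, l i * inner ℝ (e i) x ^ 2 := by
  rw [h.apply, sum_inner]
  refine Finset.sum_congr rfl fun i _ => ?_
  rw [inner_smul_left]
  simp
  ring

lemma norm_sq_apply (h : PosDiag T e l) (x : E) :
    ‖T x‖ ^ 2 = ∑ i, l i ^ 2 * inner ℝ (e i) x ^ 2 := by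
  rw [← real_inner_self_eq_norm_sq]
  nth_rewrite 1 [h.apply]
  rw [sum_inner]
  refine Finset.sum_congr rfl fun i _ => ?_
  rw [inner_smul_left, h.inner_apply]
  simp
  ring

lemma sum_sq_le (h : PosDiag T e l) (s : Finset (Fin N)) (x : E) :
    ∑ i ∈ s, inner ℝ (e i) x ^ 2 ≤ ‖x‖ ^ 2 := by
  have := h.orthonormal.sum_inner_products_le x (s := s)
  simpa using this

lemma basis_mem_eigSpace (h : PosDiag T e l) (i : Fin N) : e i ∈ eigSpace T (l i) :=
  Module.End.mem_eigenspace_iff.2 (h.apply_basis i)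

/-- An eigenvector for `μ ≠ 0` equals `μ⁻¹ • T x`, hence lies in the span of the `e i`; comparing
coefficients of `T x` and `μ • x` kills those with `l i ≠ μ`. -/
lemma eigSpace_le (h : PosDiag T e l) {μ : ℝ} (hμ : μ ≠ 0) :
    eigSpace T μ ≤ Submodule.span ℝ (e '' {i | l i = μ}) := by
  intro x hx
  have hx' : T x = μ • x := Module.End.mem_eigenspace_iff.1 hx
  have h1 : x = ∑ i, (μ⁻¹ * (l i * inner ℝ (e i) x)) • e i := by
    have := h.apply x
    rw [hx'] at this
    calc x = μ⁻¹ • (μ • x) := by rw [smul_smul, inv_mul_cancel₀ hμ, one_smul]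
      _ = _ := by rw [this, Finset.smul_sum]; simp only [smul_smul]
  rw [h1]
  refine Submodule.sum_mem _ fun i _ => ?_
  by_cases hi : l i = μ
  · exact Submodule.smul_mem _ _ (Submodule.subset_span ⟨i, hi, rfl⟩)
  · have h2 := h.inner_apply i x
    rw [hx', inner_smul_right] at h2
    have h3 : inner ℝ (e i) x = 0 := by
      have : (l i - μ) * inner ℝ (e i) x = 0 := by linarith
      exact (mul_eq_zero.1 this).resolve_left (sub_ne_zero.2 hi)
    rw [h3, mul_zero, mul_zero, zero_smul]
    exact Submodule.zero_mem _

lemma iSup_eigSpace (h : PosDiag T e l) {S : Set ℝ} (hS : (0 : ℝ) ∉ S) :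
    ⨆ μ ∈ S, eigSpace T μ = Submodule.span ℝ (e '' {i | l i ∈ S}) := by
  refine le_antisymm (iSup₂_le fun μ hμ => ?_) (Submodule.span_le.2 ?_)
  · refine (h.eigSpace_le fun h0 => hS (h0 ▸ hμ)).trans (Submodule.span_mono ?_)
    rintro _ ⟨i, hi, rfl⟩
    exact ⟨i, by rw [Set.mem_ofPred_eq] at hi ⊢; rwa [hi], rfl⟩
  · rintro _ ⟨i, hi, rfl⟩
    exact Submodule.mem_iSup_of_mem (l i) (Submodule.mem_iSup_of_mem hi (h.basis_mem_eigSpace i))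

lemma eigSpace_ne_bot_iff (h : PosDiag T e l) {μ : ℝ} (hμ : μ ≠ 0) :
    eigSpace T μ ≠ ⊥ ↔ ∃ i, l i = μ := by
  constructor
  · intro hne
    by_contra! hcon
    refine hne (le_bot_iff.1 ((h.eigSpace_le hμ).trans ?_))
    have : {i | l i = μ} = ∅ := by ext i; simpa using hcon i
    simp [this]
  · rintro ⟨i, rfl⟩ hbot
    have := h.basis_mem_eigSpace i
    rw [hbot, Submodule.mem_bot] at this
    have h1 := h.orthonormal.1 i
    rw [this, norm_zero] at h1
    exact zero_ne_one h1

lemma finrank_span (h : PosDiag T e l) (c : ℝ) :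
    Module.finrank ℝ (Submodule.span ℝ (e '' {i | c ≤ l i}))
      = (Finset.univ.filter fun i => c ≤ l i).card := by
  classical
  have h1 : e '' {i | c ≤ l i} = Set.range fun i : {i // c ≤ l i} => e i := by
    ext x; simp
  have h2 := finrank_span_eq_card (h.orthonormal.linearIndependent.comp
    (Subtype.val : {i // c ≤ l i} → Fin N) Subtype.val_injective)
  rw [Fintype.card_subtype] at h2
  rw [h1]
  exact h2

lemma finrank_iSup_eigSpace (h : PosDiag T e l) {c : ℝ} (hc : 0 < c) :
    Module.finrank ℝ (⨆ ν ∈ Set.Ici c, eigSpace T ν : Submodule ℝ E)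
      = (Finset.univ.filter fun i => c ≤ l i).card := by
  rw [h.iSup_eigSpace (by simpa using hc)]
  exact h.finrank_span c

/-- The defining property of the ordered eigenvalues in terms of the counting function. -/
lemma le_posEig_iff (h : PosDiag T e l) {c : ℝ} (hc : 0 < c) {p : ℕ} (hp : 1 ≤ p) :
    c ≤ posEig T p ↔ p ≤ (Finset.univ.filter fun i => c ≤ l i).card := by
  classical
  have hset : {μ : ℝ | 0 < μ ∧ eigSpace T μ ≠ ⊥ ∧
      p ≤ Module.finrank ℝ (⨆ ν ∈ Set.Ici μ, eigSpace T ν : Submodule ℝ E)}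
      = {μ : ℝ | (∃ i, l i = μ) ∧ p ≤ (Finset.univ.filter fun i => μ ≤ l i).card} := by
    ext μ
    constructor
    · rintro ⟨h1, h2, h3⟩
      exact ⟨(h.eigSpace_ne_bot_iff h1.ne').1 h2, by rwa [← h.finrank_iSup_eigSpace h1]⟩
    · rintro ⟨⟨i, rfl⟩, h3⟩
      exact ⟨h.pos i, (h.eigSpace_ne_bot_iff (h.pos i).ne').2 ⟨i, rfl⟩,
        by rwa [h.finrank_iSup_eigSpace (h.pos i)]⟩
  rw [posEig, hset]
  set S := {μ : ℝ | (∃ i, l i = μ) ∧ p ≤ (Finset.univ.filter fun i => μ ≤ l i).card} with hS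
  have hfin : S.Finite := (Set.finite_range l).subset fun μ hμ => hμ.1
  constructor
  · intro hle
    rcases S.eq_empty_or_nonempty with h0 | hne
    · rw [h0, Real.sSup_empty] at hle
      exact absurd hle (not_le.2 hc)
    · have hmem := hne.csSup_mem hfin
      refine hmem.2.trans (Finset.card_le_card fun i hi => ?_)
      rw [Finset.mem_filter] at hi ⊢
      exact ⟨hi.1, hle.trans hi.2⟩
  · intro hle
    have hne : (Finset.univ.filter fun i => c ≤ l i).Nonempty := Finset.card_pos.1 (by omega)
    -- The least `l i` above `c` has the same count as `c`, so it is an admissible eigenvalue and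
    -- bounds `c`.
    obtain ⟨i, hi, hmin⟩ := Finset.exists_min_image _ l hne
    refine (Finset.mem_filter.1 hi).2.trans (le_csSup hfin.bddAbove ⟨⟨i, rfl⟩, ?_⟩)
    exact hle.trans (Finset.card_le_card fun j hj =>
      Finset.mem_filter.2 ⟨Finset.mem_univ _, hmin j hj⟩)

end PosDiag

lemma posEig_nonneg (T : E →L[ℝ] E) (p : ℕ) : 0 ≤ posEig T p :=
  Real.sSup_nonneg fun _ hμ => hμ.1.le

namespace PosDiag

variable {T : E →L[ℝ] E} {N : ℕ} {e : Fin N → E} {l : Fin N → ℝ}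

/-- The number of `l j` above a threshold stays the same when the threshold rises from `posEig T p`
to the least `l i` not below it, so by maximality the two agree. -/
lemma posEig_eq_zero_or (h : PosDiag T e l) {p : ℕ} (hp : 1 ≤ p) :
    posEig T p = 0 ∨ ∃ i, l i = posEig T p := by
  classical
  rcases (posEig_nonneg T p).eq_or_lt with h0 | hpos
  · exact Or.inl h0.symm
  right
  have h1 := (h.le_posEig_iff hpos hp).1 le_rfl
  have hne : (Finset.univ.filter fun i => posEig T p ≤ l i).Nonempty := Finset.card_pos.1 (by omega)
  obtain ⟨i, hi, hmin⟩ := Finset.exists_min_image _ l hne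
  refine ⟨i, le_antisymm ((h.le_posEig_iff (h.pos i) hp).2 (h1.trans ?_)) (Finset.mem_filter.1 hi).2⟩
  exact Finset.card_le_card fun j hj => Finset.mem_filter.2 ⟨Finset.mem_univ _, hmin j hj⟩

/-- Take for `p` the number of `l j` that are at least `l i`: any larger threshold loses the index
`i` itself. -/
lemma exists_posEig_eq (h : PosDiag T e l) (i : Fin N) : ∃ p, 1 ≤ p ∧ posEig T p = l i := by
  classical
  have hp : 1 ≤ (Finset.univ.filter fun j => l i ≤ l j).card :=
    Finset.card_pos.2 ⟨i, by simp⟩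
  refine ⟨_, hp, le_antisymm ?_ ((h.le_posEig_iff (h.pos i) hp).2 le_rfl)⟩
  by_contra! hlt
  have h1 := (h.le_posEig_iff ((h.pos i).trans hlt) hp).1 le_rfl
  refine absurd h1 (not_le.2 (Finset.card_lt_card ?_))
  rw [Finset.ssubset_iff_of_subset]
  · exact ⟨i, by simp, by simpa using hlt⟩
  · intro j hj
    rw [Finset.mem_filter] at hj ⊢
    exact ⟨hj.1, hlt.le.trans hj.2⟩

/-- The Courant–Fischer bound. -/
lemma finrank_le_card (h : PosDiag T e l) {c : ℝ} (hc : 0 < c) (V : Submodule ℝ E)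
    (hV : ∀ x ∈ V, c * ‖x‖ ^ 2 ≤ inner ℝ (T x) x) :
    Module.finrank ℝ V ≤ (Finset.univ.filter fun i => c ≤ l i).card := by
  classical
  -- The coordinates along the `e i` with `c ≤ l i` are injective on `V`. If they all vanish at some
  -- `x ≠ 0`, then either every coordinate vanishes and the form is `0`, or one with `l i < c` does
  -- not and Bessel's inequality makes the form strictly less than `c * ‖x‖ ^ 2`.
  let φ : V →ₗ[ℝ] ({i // c ≤ l i} → ℝ) :=
    LinearMap.pi fun i => ((innerSL ℝ (e i) : E →L[ℝ] ℝ) : E →ₗ[ℝ] ℝ) ∘ₗ V.subtype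
  have hφ : ∀ x i, φ x i = inner ℝ (e i) (x : E) := fun x i => rfl
  have hinj : Function.Injective φ := by
    rw [← LinearMap.ker_eq_bot, LinearMap.ker_eq_bot']
    intro x hx
    have hz : ∀ i, c ≤ l i → inner ℝ (e i) (x : E) = 0 := fun i hi => by
      rw [← hφ x ⟨i, hi⟩, hx]; rfl
    have h1 := hV x x.2
    rw [h.inner_apply_self] at h1
    by_contra hne
    have hpos : 0 < ‖(x : E)‖ ^ 2 := by
      have : (x : E) ≠ 0 := fun h0 => hne (Subtype.ext h0)
      positivity
    by_cases hall : ∀ i, inner ℝ (e i) (x : E) = 0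
    · simp only [hall] at h1
      simp at h1
      nlinarith
    · push Not at hall
      obtain ⟨i, hi⟩ := hall
      have hlt : ∑ i, l i * inner ℝ (e i) (x : E) ^ 2 < ∑ i, c * inner ℝ (e i) (x : E) ^ 2 := by
        refine Finset.sum_lt_sum (fun j _ => ?_) ⟨i, Finset.mem_univ _, ?_⟩
        · by_cases hj : c ≤ l j
          · simp [hz j hj]
          · exact mul_le_mul_of_nonneg_right (not_le.1 hj).le (sq_nonneg _)
        · have hi' : l i < c := not_le.1 fun hci => hi (hz i hci)
          exact mul_lt_mul_of_pos_right hi' (by positivity)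
      rw [← Finset.mul_sum] at hlt
      have := mul_le_mul_of_nonneg_left (h.sum_sq_le Finset.univ (x : E)) hc.le
      linarith
  have := LinearMap.finrank_le_finrank_of_injective hinj
  rwa [Module.finrank_pi, Fintype.card_subtype] at this

lemma mem_span_expand (h : PosDiag T e l) {J : Set (Fin N)} {x : E}
    (hx : x ∈ Submodule.span ℝ (e '' J)) :
    (∀ i, i ∉ J → inner ℝ (e i) x = 0) ∧ x = ∑ i, inner ℝ (e i) x • e i := by
  classical
  have ho := orthonormal_iff_ite.1 h.orthonormal
  induction hx using Submodule.span_induction with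
  | mem x hx =>
    obtain ⟨j, hj, rfl⟩ := hx
    refine ⟨fun i hi => ?_, ?_⟩
    · rw [ho, if_neg]; rintro rfl; exact hi hj
    · simp [ho]
  | zero => simp
  | add x y _ _ hx hy =>
    refine ⟨fun i hi => by rw [inner_add_right, hx.1 i hi, hy.1 i hi, add_zero], ?_⟩
    simp only [inner_add_right, add_smul, Finset.sum_add_distrib]
    rw [← hx.2, ← hy.2]
  | smul a x _ hx =>
    refine ⟨fun i hi => by rw [inner_smul_right, hx.1 i hi, mul_zero], ?_⟩
    simp only [inner_smul_right, mul_smul, ← Finset.smul_sum]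
    rw [← hx.2]

lemma norm_sq_of_mem_span (h : PosDiag T e l) {J : Set (Fin N)} {x : E}
    (hx : x ∈ Submodule.span ℝ (e '' J)) : ‖x‖ ^ 2 = ∑ i, inner ℝ (e i) x ^ 2 := by
  rw [← real_inner_self_eq_norm_sq]
  nth_rewrite 1 [(h.mem_span_expand hx).2]
  rw [sum_inner]
  refine Finset.sum_congr rfl fun i _ => ?_
  rw [inner_smul_left]
  simp
  ring

lemma le_inner_of_mem_span (h : PosDiag T e l) {c : ℝ} {x : E}
    (hx : x ∈ Submodule.span ℝ (e '' {i | c ≤ l i})) : c * ‖x‖ ^ 2 ≤ inner ℝ (T x) x := by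
  rw [h.inner_apply_self, h.norm_sq_of_mem_span hx, Finset.mul_sum]
  refine Finset.sum_le_sum fun i _ => ?_
  by_cases hi : c ≤ l i
  · exact mul_le_mul_of_nonneg_right hi (sq_nonneg _)
  · rw [(h.mem_span_expand hx).1 i hi]; simp

/-- Weyl's inequality. -/
lemma posEig_sub_le (h : PosDiag T e l) {T' : E →L[ℝ] E} {N' : ℕ} {e' : Fin N' → E}
    {l' : Fin N' → ℝ} (h' : PosDiag T' e' l') {p : ℕ} (hp : 1 ≤ p) :
    posEig T p - posEig T' p ≤ ‖T - T'‖ := by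
  by_contra! hlt
  have hc' : 0 ≤ posEig T' p := posEig_nonneg T' p
  have hT : 0 < posEig T p := by linarith [norm_nonneg (T - T')]
  -- The negated claim makes this threshold positive, as the counting criterion for `T'` requires.
  -- The test space is spanned by the eigenvectors of `T` with eigenvalue at least `posEig T p`.
  have hc : 0 < posEig T p - ‖T - T'‖ := by linarith
  have h1 := (h.le_posEig_iff hT hp).1 le_rfl
  rw [← h.finrank_span] at h1
  have h2 := h1.trans (h'.finrank_le_card hc _ fun x hx => ?_)
  · have := (h'.le_posEig_iff hc hp).2 h2
    linarith
  · have h3 := h.le_inner_of_mem_span hx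
    have h4 : inner ℝ (T x) x - inner ℝ (T' x) x ≤ ‖T - T'‖ * ‖x‖ ^ 2 := by
      rw [← inner_sub_left]
      have h5 := real_inner_le_norm ((T - T') x) x
      have h6 := (T - T').le_opNorm x
      have h7 := mul_le_mul_of_nonneg_right h6 (norm_nonneg x)
      calc inner ℝ (T x - T' x) x ≤ _ := h5
        _ ≤ _ := h7
        _ = _ := by ring
    linarith [sub_mul (posEig T p) ‖T - T'‖ (‖x‖ ^ 2)]

lemma abs_posEig_sub_le (h : PosDiag T e l) {T' : E →L[ℝ] E} {N' : ℕ} {e' : Fin N' → E}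
    {l' : Fin N' → ℝ} (h' : PosDiag T' e' l') {p : ℕ} (hp : 1 ≤ p) :
    |posEig T p - posEig T' p| ≤ ‖T - T'‖ := by
  rw [abs_sub_le_iff]
  exact ⟨h.posEig_sub_le h' hp, by rw [norm_sub_rev]; exact h'.posEig_sub_le h hp⟩

/-- Since `-T` is negative semidefinite, the supremum is over the empty set and takes its default
value `0`. -/
lemma eig_of_neg (h : PosDiag T e l) {p : ℤ} (hp : p < 0) : eig T p = 0 := by
  rw [eig, if_neg (by omega), posEig]
  have : {μ : ℝ | 0 < μ ∧ eigSpace (-T) μ ≠ ⊥ ∧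
      (-p).toNat ≤ Module.finrank ℝ (⨆ ν ∈ Set.Ici μ, eigSpace (-T) ν : Submodule ℝ E)} = ∅ := by
    rw [Set.eq_empty_iff_forall_notMem]
    rintro μ ⟨hμ, hne, -⟩
    refine hne ((Submodule.eq_bot_iff _).2 fun x hx => ?_)
    have hx' : (-T) x = μ • x := Module.End.mem_eigenspace_iff.1 hx
    have h1 : 0 ≤ inner ℝ (T x) x := by
      rw [h.inner_apply_self]
      exact Finset.sum_nonneg fun i _ => mul_nonneg (h.pos i).le (sq_nonneg _)
    have h2 : T x = -(μ • x) := by rw [← hx']; simp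
    rw [h2, inner_neg_left, inner_smul_left, real_inner_self_eq_norm_sq] at h1
    have h3 : μ * ‖x‖ ^ 2 ≤ 0 := by simpa using h1
    have h4 : ‖x‖ ^ 2 ≤ 0 := by
      by_contra! h5
      nlinarith
    simpa using le_antisymm h4 (sq_nonneg _)
  rw [this, Real.sSup_empty, neg_zero]

end PosDiag

/-! ### The positive spectrum as a function of the Gram matrix. -/

section Gram

variable {E' : Type*} [NormedAddCommGroup E'] [InnerProductSpace ℝ E'] {ι : Type*}

/-- Equal Gram matrices mean that `v a ↦ v' a` extends to an isometry `U` of the spans, and the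
operator `B` below is `U ∘ T`. Thus `‖B x‖ = ‖T x‖` and the form of `T'` at `B x` is that of `T` at
`T x`. On the span `V` of the eigenvectors with eigenvalue at least `c`, which `T` preserves, `B` is
injective, so `B V` is a test space for the Courant–Fischer bound on `T'`. -/
lemma card_le_card_of_gram_eq {s : Finset ι} {v : ι → E} {v' : ι → E'}
    (hgram : ∀ a ∈ s, ∀ b ∈ s, inner ℝ (v a) (v b) = inner ℝ (v' a) (v' b))
    {T : E →L[ℝ] E} {T' : E' →L[ℝ] E'}
    (hT : T = ∑ a ∈ s, InnerProductSpace.rankOne ℝ (v a) (v a))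
    (hT' : T' = ∑ a ∈ s, InnerProductSpace.rankOne ℝ (v' a) (v' a))
    {N : ℕ} {e : Fin N → E} {l : Fin N → ℝ} (h : PosDiag T e l)
    {N' : ℕ} {e' : Fin N' → E'} {l' : Fin N' → ℝ} (h' : PosDiag T' e' l') {c : ℝ} (hc : 0 < c) :
    (Finset.univ.filter fun i => c ≤ l i).card ≤ (Finset.univ.filter fun i => c ≤ l' i).card := by
  set V := Submodule.span ℝ (e '' {i | c ≤ l i}) with hV
  set B : E →L[ℝ] E' := ∑ a ∈ s, InnerProductSpace.rankOne ℝ (v' a) (v a) with hB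
  have hTx : ∀ x, T x = ∑ a ∈ s, inner ℝ (v a) x • v a := fun x => by
    rw [hT]; simp
  have hTx' : ∀ x, T' x = ∑ a ∈ s, inner ℝ (v' a) x • v' a := fun x => by
    rw [hT']; simp
  have hBx : ∀ x, B x = ∑ a ∈ s, inner ℝ (v a) x • v' a := fun x => by
    rw [hB]; simp
  have hinner : ∀ x, ∀ a ∈ s, inner ℝ (v' a) (B x) = inner ℝ (v a) (T x) := fun x a ha => by
    rw [hBx, hTx, inner_sum, inner_sum]
    refine Finset.sum_congr rfl fun b hb => ?_
    rw [inner_smul_right, inner_smul_right, hgram a ha b hb]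
  have hnorm : ∀ x, ‖B x‖ ^ 2 = ‖T x‖ ^ 2 := fun x => by
    rw [← real_inner_self_eq_norm_sq, ← real_inner_self_eq_norm_sq]
    nth_rewrite 1 [hBx x]
    nth_rewrite 1 [hTx x]
    rw [sum_inner, sum_inner]
    refine Finset.sum_congr rfl fun a ha => ?_
    rw [inner_smul_left, inner_smul_left, hinner x a ha]
  have hquad : ∀ x, inner ℝ (T' (B x)) (B x) = inner ℝ (T (T x)) (T x) := fun x => by
    rw [hTx', hTx (T x), sum_inner, sum_inner]
    refine Finset.sum_congr rfl fun a ha => ?_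
    rw [inner_smul_left, inner_smul_left, hinner x a ha]
  have hTV : ∀ x ∈ V, T x ∈ V := by
    intro x hx
    rw [h.apply]
    refine Submodule.sum_mem _ fun i _ => ?_
    by_cases hi : c ≤ l i
    · exact Submodule.smul_mem _ _ (Submodule.subset_span ⟨i, hi, rfl⟩)
    · rw [(h.mem_span_expand hx).1 i hi]; simp
  have hinj : Function.Injective ((B : E →ₗ[ℝ] E').domRestrict V) := by
    rw [← LinearMap.ker_eq_bot, LinearMap.ker_eq_bot']
    intro x hx
    have h1 : B (x : E) = 0 := hx
    have h2 := hnorm x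
    rw [h1, norm_zero] at h2
    have h3 : T (x : E) = 0 := by
      rw [← norm_eq_zero]
      exact pow_eq_zero_iff (two_ne_zero) |>.1 (by rw [← h2]; norm_num)
    have h4 := h.le_inner_of_mem_span x.2
    rw [h3, inner_zero_left] at h4
    have h5 : ‖(x : E)‖ ^ 2 ≤ 0 := by
      by_contra! h6
      nlinarith
    have h6 : (x : E) = 0 := by simpa using le_antisymm h5 (sq_nonneg _)
    exact Subtype.ext h6
  rw [← h.finrank_span, ← hV, ← LinearMap.finrank_range_of_inj hinj]
  refine h'.finrank_le_card hc _ ?_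
  rintro _ ⟨x, rfl⟩
  change c * ‖B (x : E)‖ ^ 2 ≤ inner ℝ (T' (B (x : E))) (B (x : E))
  rw [hnorm, hquad]
  exact h.le_inner_of_mem_span (hTV x x.2)

/-- The positive eigenvalues of `∑ a, v a ⊗ v a` depend only on the Gram matrix of `v`. -/
lemma posEig_eq_of_gram_eq {s : Finset ι} {v : ι → E} {v' : ι → E'}
    (hgram : ∀ a ∈ s, ∀ b ∈ s, inner ℝ (v a) (v b) = inner ℝ (v' a) (v' b))
    {T : E →L[ℝ] E} {T' : E' →L[ℝ] E'}
    (hT : T = ∑ a ∈ s, InnerProductSpace.rankOne ℝ (v a) (v a))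
    (hT' : T' = ∑ a ∈ s, InnerProductSpace.rankOne ℝ (v' a) (v' a))
    {N : ℕ} {e : Fin N → E} {l : Fin N → ℝ} (h : PosDiag T e l)
    {N' : ℕ} {e' : Fin N' → E'} {l' : Fin N' → ℝ} (h' : PosDiag T' e' l') {p : ℕ} (hp : 1 ≤ p) :
    posEig T p = posEig T' p := by
  have key : ∀ c, 0 < c → (c ≤ posEig T p ↔ c ≤ posEig T' p) := fun c hc => by
    rw [h.le_posEig_iff hc hp, h'.le_posEig_iff hc hp,
      le_antisymm (card_le_card_of_gram_eq hgram hT hT' h h' hc)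
        (card_le_card_of_gram_eq (fun a ha b hb => (hgram a ha b hb).symm) hT' hT h' h hc)]
  refine le_antisymm ?_ ?_
  · rcases (posEig_nonneg T p).eq_or_lt with h0 | h0
    · rw [← h0]; exact posEig_nonneg T' p
    · exact (key _ h0).1 le_rfl
  · rcases (posEig_nonneg T' p).eq_or_lt with h0 | h0
    · rw [← h0]; exact posEig_nonneg T p
    · exact (key _ h0).2 le_rfl

end Gram

/-! ### Sums of rank-one operators `v a ⊗ v a`. -/

section SumRankOne

variable {ι : Type*} (s : Finset ι) (v : ι → E)

lemma inner_sum_rankOne_self (x : E) :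
    inner ℝ ((∑ a ∈ s, InnerProductSpace.rankOne ℝ (v a) (v a) : E →L[ℝ] E) x) x
      = ∑ a ∈ s, inner ℝ (v a) x ^ 2 := by
  simp only [sum_apply, InnerProductSpace.rankOne_apply, sum_inner,
    inner_smul_left]
  refine Finset.sum_congr rfl fun a _ => ?_
  simp
  ring

lemma isSymmetric_sum_rankOne :
    ((∑ a ∈ s, InnerProductSpace.rankOne ℝ (v a) (v a) : E →L[ℝ] E) : E →ₗ[ℝ] E).IsSymmetric := by
  intro x y
  change inner ℝ ((∑ a ∈ s, InnerProductSpace.rankOne ℝ (v a) (v a) : E →L[ℝ] E) x) y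
    = inner ℝ x ((∑ a ∈ s, InnerProductSpace.rankOne ℝ (v a) (v a) : E →L[ℝ] E) y)
  simp only [sum_apply, InnerProductSpace.rankOne_apply, sum_inner, inner_sum,
    inner_smul_left, inner_smul_right]
  refine Finset.sum_congr rfl fun a _ => ?_
  rw [real_inner_comm x (v a)]
  simp
  ring

lemma finiteDimensional_range_sum_rankOne : FiniteDimensional ℝ
    ((∑ a ∈ s, InnerProductSpace.rankOne ℝ (v a) (v a) : E →L[ℝ] E) : E →ₗ[ℝ] E).range := by
  classical
  have := FiniteDimensional.span_finset ℝ (s.image v)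
  refine Submodule.finiteDimensional_of_le (S₂ := Submodule.span ℝ (s.image v : Set E)) ?_
  rintro _ ⟨x, rfl⟩
  change (∑ a ∈ s, InnerProductSpace.rankOne ℝ (v a) (v a) : E →L[ℝ] E) x ∈ _
  simp only [sum_apply, InnerProductSpace.rankOne_apply]
  exact Submodule.sum_mem _ fun a ha => Submodule.smul_mem _ _
    (Submodule.subset_span (Finset.mem_coe.2 (Finset.mem_image_of_mem v ha)))

lemma exists_posDiag_sum_rankOne : ∃ (N : ℕ) (e : Fin N → E) (l : Fin N → ℝ),
    PosDiag (∑ a ∈ s, InnerProductSpace.rankOne ℝ (v a) (v a)) e l :=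
  exists_posDiag _ (isSymmetric_sum_rankOne s v) (finiteDimensional_range_sum_rankOne s v)
    fun x => by
      rw [inner_sum_rankOne_self]
      exact Finset.sum_nonneg fun _ _ => sq_nonneg _

lemma isCompactOperator_rankOne (a b : E) :
    IsCompactOperator (InnerProductSpace.rankOne ℝ a b : E →L[ℝ] E) := by
  rw [InnerProductSpace.rankOne_def']
  have : IsCompactOperator (innerSL ℝ b : E →L[ℝ] ℝ) := by
    have h := ((isCompactOperator_id_iff_finiteDimensional (𝕜 := ℝ) (E := ℝ)).2 inferInstance)
    exact h.comp_clm (innerSL ℝ b)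
  exact this.clm_comp (ContinuousLinearMap.toSpanSingleton ℝ a)

lemma isCompactOperator_sum_rankOne :
    IsCompactOperator (∑ a ∈ s, InnerProductSpace.rankOne ℝ (v a) (v a) : E →L[ℝ] E) := by
  classical
  induction s using Finset.induction_on with
  | empty => exact isCompactOperator_zero (M₁ := E) (M₂ := E)
  | insert a s ha ih =>
    rw [Finset.sum_insert ha]
    exact (isCompactOperator_rankOne _ _).add ih

end SumRankOne

end Spectral

/-! ### Perturbation of spectral projectors. -/

section SpectralProj

variable {E : Type*} [NormedAddCommGroup E] [InnerProductSpace ℝ E]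

/-- Write `P`, `P'` for the projections and split `z` into `P z` and `y = z - P z`. The first part
is moved by `P'` by at most `κ * ‖z‖`. For the second, `w = P' y` satisfies `‖w‖² = ⟪w, y⟫ = ⟪w - P
w, y⟫ ≤ κ * ‖w‖ * ‖z‖`, because `y` is orthogonal to `V`. -/
lemma norm_starProjection_sub_le {V V' : Submodule ℝ E} [V.HasOrthogonalProjection]
    [V'.HasOrthogonalProjection] {κ : ℝ} (hκ : 0 ≤ κ)
    (h : ∀ x ∈ V, ‖x - V'.starProjection x‖ ≤ κ * ‖x‖)
    (h' : ∀ x ∈ V', ‖x - V.starProjection x‖ ≤ κ * ‖x‖) :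
    ‖V'.starProjection - V.starProjection‖ ≤ 2 * κ := by
  refine ContinuousLinearMap.opNorm_le_bound _ (by positivity) fun z => ?_
  have h1 : ‖V.starProjection z - V'.starProjection (V.starProjection z)‖ ≤ κ * ‖z‖ :=
    (h _ (V.starProjection_apply_mem z)).trans
      (mul_le_mul_of_nonneg_left (V.norm_starProjection_apply_le z) hκ)
  set y := z - V.starProjection z with hy
  have hyV : y ∈ Vᗮ := V.sub_starProjection_mem_orthogonal z
  have hyz : ‖y‖ ≤ ‖z‖ := by
    have := Vᗮ.norm_starProjection_apply_le z
    rwa [Submodule.starProjection_orthogonal_val] at this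
  set w := V'.starProjection y with hw
  have hwV : w ∈ V' := V'.starProjection_apply_mem y
  have h2 : ‖w‖ * ‖w‖ ≤ ‖w‖ * (κ * ‖z‖) := by
    have e1 : inner ℝ w w = inner ℝ w y := by
      have h3 : inner ℝ (V'.starProjection y) w = inner ℝ y (V'.starProjection w) :=
        V'.inner_starProjection_left_eq_right y w
      rw [Submodule.starProjection_eq_self_iff.2 hwV] at h3
      rw [real_inner_comm y w, ← h3]
    have e2 : inner ℝ w y = inner ℝ (w - V.starProjection w) y := by
      rw [inner_sub_left, hyV _ (V.starProjection_apply_mem w), sub_zero]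
    calc ‖w‖ * ‖w‖ = inner ℝ w w := (real_inner_self_eq_norm_mul_norm w).symm
      _ = inner ℝ (w - V.starProjection w) y := by rw [e1, e2]
      _ ≤ ‖w - V.starProjection w‖ * ‖y‖ := real_inner_le_norm _ _
      _ ≤ (κ * ‖w‖) * ‖z‖ := mul_le_mul (h' w hwV) hyz (norm_nonneg _) (by positivity)
      _ = _ := by ring
  have h3 : ‖w‖ ≤ κ * ‖z‖ := by
    rcases (norm_nonneg w).eq_or_lt with h0 | h0
    · rw [← h0]; positivity
    · exact le_of_mul_le_mul_left h2 h0
  have h4 : (V'.starProjection - V.starProjection) z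
      = w - (V.starProjection z - V'.starProjection (V.starProjection z)) := by
    rw [hw, hy, map_sub, sub_apply]
    abel
  rw [h4]
  calc _ ≤ ‖w‖ + ‖V.starProjection z - V'.starProjection (V.starProjection z)‖ := norm_sub_le _ _
    _ ≤ κ * ‖z‖ + κ * ‖z‖ := add_le_add h3 h1
    _ = _ := by ring

namespace PosDiag

variable {T : E →L[ℝ] E} {N : ℕ} {e : Fin N → E} {l : Fin N → ℝ}

/-- The `e i` need not span `E`. On their orthogonal complement `T` vanishes and `T - μ` has size
`|μ|`, so the identity is arranged as `μ ^ 2 * ‖x‖ ^ 2` plus a correction along each `e i`. -/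
lemma norm_sq_apply_sub (h : PosDiag T e l) (μ : ℝ) (x : E) :
    ‖T x - μ • x‖ ^ 2
      = ∑ i, ((l i - μ) ^ 2 - μ ^ 2) * inner ℝ (e i) x ^ 2 + μ ^ 2 * ‖x‖ ^ 2 := by
  have h1 : ∑ i, ((l i - μ) ^ 2 - μ ^ 2) * inner ℝ (e i) x ^ 2
      = ‖T x‖ ^ 2 - 2 * μ * inner ℝ (T x) x := by
    rw [h.norm_sq_apply, h.inner_apply_self, Finset.mul_sum, ← Finset.sum_sub_distrib]
    exact Finset.sum_congr rfl fun i _ => by ring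
  rw [h1, norm_sub_sq_real, inner_smul_right, norm_smul, Real.norm_eq_abs, mul_pow, sq_abs]
  ring

lemma norm_apply_sub_le (h : PosDiag T e l) {J : Set (Fin N)} {μ η : ℝ} (hη : 0 ≤ η)
    (hJ : ∀ i ∈ J, |l i - μ| ≤ η) {x : E} (hx : x ∈ Submodule.span ℝ (e '' J)) :
    ‖T x - μ • x‖ ≤ η * ‖x‖ := by
  refine le_of_sq_le_sq ?_ (by positivity)
  rw [h.norm_sq_apply_sub, mul_pow, h.norm_sq_of_mem_span hx, Finset.mul_sum, Finset.mul_sum,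
    ← Finset.sum_add_distrib]
  refine Finset.sum_le_sum fun i _ => ?_
  by_cases hi : i ∈ J
  · have h1 : (l i - μ) ^ 2 ≤ η ^ 2 := by
      rw [← sq_abs]; exact pow_le_pow_left₀ (abs_nonneg _) (hJ i hi) 2
    nlinarith [sq_nonneg (inner ℝ (e i) x)]
  · rw [(h.mem_span_expand hx).1 i hi]; simp

/-- The condition `δ ≤ μ` is the gap to the eigenvalue `0`, needed for the component of `y` in the
kernel of `T`. -/
lemma mul_norm_le_norm_apply_sub (h : PosDiag T e l) {J : Set (Fin N)} {μ δ : ℝ} (hδ : 0 ≤ δ)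
    (hδμ : δ ≤ μ) (hJ : ∀ i, i ∉ J → δ ≤ |l i - μ|) {y : E}
    (hy : ∀ i ∈ J, inner ℝ (e i) y = 0) : δ * ‖y‖ ≤ ‖T y - μ • y‖ := by
  refine le_of_sq_le_sq ?_ (norm_nonneg _)
  rw [h.norm_sq_apply_sub]
  have h1 : ∑ i, (δ ^ 2 - μ ^ 2) * inner ℝ (e i) y ^ 2
      ≤ ∑ i, ((l i - μ) ^ 2 - μ ^ 2) * inner ℝ (e i) y ^ 2 := by
    refine Finset.sum_le_sum fun i _ => ?_
    by_cases hi : i ∈ J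
    · rw [hy i hi]; simp
    · have h2 : δ ^ 2 ≤ (l i - μ) ^ 2 := by
        rw [← sq_abs (l i - μ)]; exact pow_le_pow_left₀ hδ (hJ i hi) 2
      nlinarith [sq_nonneg (inner ℝ (e i) y)]
  rw [← Finset.mul_sum] at h1
  have h3 := h.sum_sq_le Finset.univ y
  have h4 : δ ^ 2 ≤ μ ^ 2 := pow_le_pow_left₀ hδ hδμ 2
  nlinarith

/-- An approximate eigenvector is close to the span of the eigenvectors with near eigenvalues. -/
lemma mul_norm_sub_starProjection_le (h : PosDiag T e l) {J : Set (Fin N)} {μ δ : ℝ} (hδ : 0 ≤ δ)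
    (hδμ : δ ≤ μ) (hJ : ∀ i, i ∉ J → δ ≤ |l i - μ|) {V : Submodule ℝ E}
    [V.HasOrthogonalProjection] (hV : V = Submodule.span ℝ (e '' J)) (x : E) :
    δ * ‖x - V.starProjection x‖ ≤ ‖T x - μ • x‖ := by
  set y := x - V.starProjection x with hy
  have hmem : ∀ i ∈ J, e i ∈ V := fun i hi => hV ▸ Submodule.subset_span ⟨i, hi, rfl⟩
  have hyV : y ∈ Vᗮ := V.sub_starProjection_mem_orthogonal x
  have hyJ : ∀ i ∈ J, inner ℝ (e i) y = 0 := fun i hi => hyV _ (hmem i hi)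
  refine (h.mul_norm_le_norm_apply_sub hδ hδμ hJ hyJ).trans ?_
  -- `T - μ` preserves both `V` and its complement, so `a` and `b` are orthogonal and Pythagoras
  -- bounds `‖b‖` by `‖T x - μ • x‖`.
  set a := T (V.starProjection x) - μ • V.starProjection x with ha
  set b := T y - μ • y with hb
  have haV : a ∈ V := by
    refine Submodule.sub_mem _ ?_ (Submodule.smul_mem _ _ (V.starProjection_apply_mem x))
    rw [h.apply]
    refine Submodule.sum_mem _ fun i _ => ?_
    by_cases hi : i ∈ J
    · exact Submodule.smul_mem _ _ (hmem i hi)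
    · have h1 : V.starProjection x ∈ Submodule.span ℝ (e '' J) :=
        hV ▸ V.starProjection_apply_mem x
      rw [(h.mem_span_expand h1).1 i hi]; simp
  have hbV : b ∈ Vᗮ := by
    refine Submodule.sub_mem _ ?_ (Submodule.smul_mem _ _ hyV)
    rw [hV, Submodule.mem_orthogonal]
    intro u hu
    rw [(h.mem_span_expand hu).2, sum_inner]
    refine Finset.sum_eq_zero fun i _ => ?_
    by_cases hi : i ∈ J
    · rw [inner_smul_left, h.inner_apply, hyJ i hi]; simp
    · rw [(h.mem_span_expand hu).1 i hi]; simp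
  have hab : T x - μ • x = a + b := by
    rw [ha, hb, hy, map_sub, smul_sub]; abel
  have h0 : inner ℝ a b = 0 := hbV a haV
  refine le_of_sq_le_sq ?_ (norm_nonneg _)
  rw [hab, norm_add_sq_real, h0]
  nlinarith [sq_nonneg ‖a‖]

lemma eig_eq_posEig (T : E →L[ℝ] E) {p : ℕ} (hp : 1 ≤ p) : eig T (p : ℤ) = posEig T p := by
  rw [eig, if_pos (by omega), Int.toNat_natCast]

lemma topologicalClosure_iSup_eigSpace (h : PosDiag T e l) {S : Set ℝ} (hS : (0 : ℝ) ∉ S) :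
    (⨆ μ ∈ S, eigSpace T μ).topologicalClosure = Submodule.span ℝ (e '' {i | l i ∈ S}) := by
  rw [h.iSup_eigSpace hS]
  have : FiniteDimensional ℝ (Submodule.span ℝ (e '' {i | l i ∈ S})) :=
    FiniteDimensional.span_of_finite ℝ (Set.toFinite _)
  exact (Submodule.closed_of_finiteDimensional _).submodule_topologicalClosure_eq

lemma abs_eig_sub_le (h : PosDiag T e l) {T' : E →L[ℝ] E} {N' : ℕ} {e' : Fin N' → E}
    {l' : Fin N' → ℝ} (h' : PosDiag T' e' l') {p : ℤ} (hp : p ≠ 0) :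
    |eig T p - eig T' p| ≤ ‖T - T'‖ := by
  rcases lt_or_gt_of_ne hp with hp | hp
  · rw [h.eig_of_neg hp, h'.eig_of_neg hp]; simp
  · lift p to ℕ using hp.le
    have hp1 : 1 ≤ p := by omega
    rw [eig_eq_posEig T hp1, eig_eq_posEig T' hp1]
    exact h.abs_posEig_sub_le h' hp1

lemma eig_pos (h : PosDiag T e l) {p : ℤ} (hp : p ≠ 0) (h0 : eig T p ≠ 0) : 0 < eig T p := by
  rcases lt_or_gt_of_ne hp with hp | hp
  · exact absurd (h.eig_of_neg hp) h0
  · refine lt_of_le_of_ne ?_ h0.symm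
    rw [eig, if_pos hp]
    exact posEig_nonneg _ _

lemma tendsto_eig (h : PosDiag T e l) {T' : ℕ → E →L[ℝ] E}
    (h' : ∀ n, ∃ (N' : ℕ) (e' : Fin N' → E) (l' : Fin N' → ℝ), PosDiag (T' n) e' l')
    (hlim : Tendsto T' atTop (𝓝 T)) {p : ℤ} (hp : p ≠ 0) :
    Tendsto (fun n => |eig (T' n) p - eig T p|) atTop (𝓝 0) := by
  refine squeeze_zero (fun n => abs_nonneg _) (fun n => ?_)
    (tendsto_iff_norm_sub_tendsto_zero.1 hlim)
  obtain ⟨N', e', l', hd⟩ := h' n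
  exact hd.abs_eig_sub_le h hp

variable [CompleteSpace E]

/-- By Weyl's inequality the selected eigenvalues of `T'` stay within `‖T' - T‖` of `μ`, and the
others, which move by at most `δ` from points at distance at least `2 * δ` from `μ`, stay at
distance at least `δ`. Vectors of either spectral subspace are thus approximate eigenvectors of the
other operator, hence close to its spectral subspace. -/
lemma norm_spectralProj_sub_le (h : PosDiag T e l) {T' : E →L[ℝ] E} {N' : ℕ} {e' : Fin N' → E}
    {l' : Fin N' → ℝ} (h' : PosDiag T' e' l') {μ δ : ℝ} (hδ : 0 < δ) (hμ : 2 * δ ≤ μ)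
    (hgap : ∀ i, l i ≠ μ → 2 * δ ≤ |l i - μ|) (hε : ‖T' - T‖ ≤ δ) :
    ‖spectralProj T' (Set.image (eig T') {q | q ≠ 0 ∧ eig T q = μ}) - spectralProj T {μ}‖
      ≤ 4 * (‖T' - T‖ / δ) := by
  set ε := ‖T' - T‖ with hεdef
  have hε0 : 0 ≤ ε := norm_nonneg _
  set S := Set.image (eig T') {q | q ≠ 0 ∧ eig T q = μ} with hS
  have hnear : ∀ ν ∈ S, |ν - μ| ≤ ε := by
    rintro _ ⟨q, ⟨hq, rfl⟩, rfl⟩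
    exact h'.abs_eig_sub_le h hq
  have hS0 : (0 : ℝ) ∉ S := fun h0 => by
    have h1 := hnear 0 h0
    rw [zero_sub, abs_neg] at h1
    linarith [le_abs_self μ]
  have hfar : ∀ i, i ∉ {i | l' i ∈ S} → δ ≤ |l' i - μ| := by
    intro i hi
    -- The eigenvalue `l' i` is the `q`-th one of `T'`. As it is not selected, the `q`-th eigenvalue
    -- of `T` is not `μ`; it is `0` or another `l j`, and both are `2 * δ` away from `μ`.
    obtain ⟨q, hq, hqi⟩ := h'.exists_posEig_eq i
    have hne : posEig T q ≠ μ := fun heq => hi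
      ⟨(q : ℤ), ⟨by omega, by rw [eig_eq_posEig T hq, heq]⟩, by rw [eig_eq_posEig T' hq, hqi]⟩
    have h1 := h'.abs_posEig_sub_le h hq
    rw [hqi] at h1
    have h2 : 2 * δ ≤ |posEig T q - μ| := by
      rcases h.posEig_eq_zero_or hq with h0 | ⟨j, hj⟩
      · rw [h0, zero_sub, abs_neg]; exact hμ.trans (le_abs_self μ)
      · rw [← hj]; exact hgap j (hj ▸ hne)
    have h3 := abs_sub_abs_le_abs_sub (posEig T q - μ) (l' i - μ)
    rw [show posEig T q - μ - (l' i - μ) = -(l' i - posEig T q) by ring, abs_neg] at h3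
    linarith
  have hfar' : ∀ i, i ∉ {i | l i ∈ ({μ} : Set ℝ)} → δ ≤ |l i - μ| := fun i hi => by
    have := hgap i hi
    linarith
  have hV := h.topologicalClosure_iSup_eigSpace (S := {μ})
    (by simpa using (by linarith : (0 : ℝ) < μ).ne)
  have hV' := h'.topologicalClosure_iSup_eigSpace hS0
  unfold spectralProj
  have hdiff : ∀ x, ‖T' x - T x‖ ≤ ε * ‖x‖ := fun x => (T' - T).le_opNorm x
  have key := norm_starProjection_sub_le (V := (⨆ ν ∈ ({μ} : Set ℝ), eigSpace T ν).topologicalClosure)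
    (V' := (⨆ ν ∈ S, eigSpace T' ν).topologicalClosure) (κ := 2 * (ε / δ)) (by positivity) ?_ ?_
  · linarith
  · intro x hx
    have h1 := h'.mul_norm_sub_starProjection_le hδ.le (by linarith) hfar hV' x
    have h2 := h.norm_apply_sub_le (η := 0) (μ := μ) le_rfl
      (fun i hi => by rw [Set.mem_ofPred_eq, Set.mem_singleton_iff] at hi; rw [hi]; simp) (hV ▸ hx)
    have h3 : ‖T' x - μ • x‖ ≤ ε * ‖x‖ := by
      have h4 : T' x - μ • x = (T' x - T x) + (T x - μ • x) := by abel
      rw [h4]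
      refine (norm_add_le _ _).trans ?_
      linarith [hdiff x]
    have h5 : ε * ‖x‖ ≤ δ * (2 * (ε / δ) * ‖x‖) := by
      have : δ * (2 * (ε / δ) * ‖x‖) = 2 * (ε * ‖x‖) := by field_simp
      rw [this]
      have : 0 ≤ ε * ‖x‖ := by positivity
      linarith
    exact le_of_mul_le_mul_left ((h1.trans h3).trans h5) hδ
  -- Here `x` is only an approximate eigenvector of `T'`, so the error `ε` enters twice; this fixes
  -- `κ = 2 * (ε / δ)` and the final constant `4`.
  · intro x hx
    have h1 := h.mul_norm_sub_starProjection_le hδ.le (by linarith) hfar' hV x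
    have h2 := h'.norm_apply_sub_le (μ := μ) hε0 (fun i hi => hnear _ hi) (hV' ▸ hx)
    have h3 : ‖T x - μ • x‖ ≤ 2 * (ε * ‖x‖) := by
      have h4 : T x - μ • x = (T' x - μ • x) - (T' x - T x) := by abel
      rw [h4]
      refine (norm_sub_le _ _).trans ?_
      linarith [hdiff x]
    have h5 : δ * (2 * (ε / δ) * ‖x‖) = 2 * (ε * ‖x‖) := by field_simp
    exact le_of_mul_le_mul_left ((h1.trans h3).trans h5.ge) hδ

/-- The value `μ` itself is put among the distances because it is the distance to the eigenvalue
`0`, which is not listed in `l`. -/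
lemma exists_gap (l : Fin N → ℝ) {μ : ℝ} (hμ : 0 < μ) :
    ∃ δ > 0, 2 * δ ≤ μ ∧ ∀ i, l i ≠ μ → 2 * δ ≤ |l i - μ| := by
  classical
  set s : Finset ℝ := insert μ ((Finset.univ.filter fun i => l i ≠ μ).image fun i => |l i - μ|)
    with hs
  have hne : s.Nonempty := Finset.insert_nonempty _ _
  have hpos : 0 < s.min' hne := by
    rw [Finset.lt_min'_iff]
    intro y hy
    rw [hs, Finset.mem_insert, Finset.mem_image] at hy
    rcases hy with rfl | ⟨i, hi, rfl⟩
    · exact hμ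
    · exact abs_pos.2 (sub_ne_zero.2 (Finset.mem_filter.1 hi).2)
  refine ⟨s.min' hne / 2, by positivity, ?_, fun i hi => ?_⟩
  · have := s.min'_le μ (Finset.mem_insert_self _ _)
    linarith
  · have := s.min'_le |l i - μ| (Finset.mem_insert_of_mem
      (Finset.mem_image_of_mem _ (Finset.mem_filter.2 ⟨Finset.mem_univ _, hi⟩)))
    linarith

lemma tendsto_spectralProj (h : PosDiag T e l) {T' : ℕ → E →L[ℝ] E}
    (h' : ∀ n, ∃ (N' : ℕ) (e' : Fin N' → E) (l' : Fin N' → ℝ), PosDiag (T' n) e' l')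
    (hlim : Tendsto T' atTop (𝓝 T)) {p : ℤ} (hp : p ≠ 0) (h0 : eig T p ≠ 0) :
    Tendsto (fun n => spectralProj (T' n) (eig (T' n) '' {q | q ≠ 0 ∧ eig T q = eig T p}))
      atTop (𝓝 (spectralProj T {eig T p})) := by
  obtain ⟨δ, hδ, hμ, hgap⟩ := exists_gap l (h.eig_pos hp h0)
  have hε : Tendsto (fun n => ‖T' n - T‖) atTop (𝓝 0) := tendsto_iff_norm_sub_tendsto_zero.1 hlim
  rw [tendsto_iff_norm_sub_tendsto_zero]
  refine squeeze_zero' (Eventually.of_forall fun n => norm_nonneg _)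
    (g := fun n => 4 * (‖T' n - T‖ / δ)) ?_ (by simpa using (hε.div_const δ).const_mul 4)
  filter_upwards [hε.eventually (eventually_le_nhds hδ)] with n hn
  obtain ⟨N', e', l', hd⟩ := h' n
  exact h.norm_spectralProj_sub_le hd hδ hμ hgap hn

end PosDiag

end SpectralProj

/-! ### From the cut norm to strong convergence of graphon operators. -/

lemma norm_sq_eq_integral (F : Signal) : ‖F‖ ^ 2 = ∫ u, F u ^ 2 := by
  rw [← real_inner_self_eq_norm_sq, L2.inner_def]
  refine integral_congr_ae (Eventually.of_forall fun u => ?_)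
  simp [pow_two]

section CutNorm

variable {k : unitInterval → unitInterval → ℝ}

/-- The bound on `k` makes the family of rectangle integrals bounded above, so that the real
supremum is a genuine upper bound. -/
lemma abs_setIntegral_le_cutNorm (hk : ∀ u v, |k u v| ≤ 1) {A B : Set unitInterval}
    (hA : MeasurableSet A) (hB : MeasurableSet B) : |∫ z in A ×ˢ B, k z.1 z.2| ≤ cutNorm k := by
  refine le_ciSup (f := fun S : {S : Set unitInterval × Set unitInterval //
    MeasurableSet S.1 ∧ MeasurableSet S.2} => |∫ z in S.1.1 ×ˢ S.1.2, k z.1 z.2|) ⟨1, ?_⟩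
    ⟨(A, B), hA, hB⟩
  rintro _ ⟨S, rfl⟩
  have h1 := norm_setIntegral_le_of_norm_le_const (μ := (volume : Measure (unitInterval × unitInterval)))
    (s := S.1.1 ×ˢ S.1.2) (f := fun z => k z.1 z.2) (C := 1) (measure_lt_top _ _)
    fun z _ => hk z.1 z.2
  refine h1.trans ?_
  rw [one_mul]
  exact measureReal_le_one

lemma integrable_kernel (hm : Measurable (Function.uncurry k)) (hk : ∀ u v, |k u v| ≤ 1) :
    Integrable (fun z : unitInterval × unitInterval => k z.1 z.2) volume :=
  Integrable.of_bound hm.aestronglyMeasurable 1 (Eventually.of_forall fun z => hk z.1 z.2)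

lemma measurable_setIntegral_kernel (hm : Measurable (Function.uncurry k)) (B : Set unitInterval) :
    Measurable fun u => ∫ v in B, k u v :=
  (StronglyMeasurable.integral_prod_right (ν := volume.restrict B) (f := k)
    hm.stronglyMeasurable).measurable

lemma integrable_setIntegral_kernel (hm : Measurable (Function.uncurry k))
    (hk : ∀ u v, |k u v| ≤ 1) (B : Set unitInterval) :
    Integrable (fun u => ∫ v in B, k u v) volume := by
  refine Integrable.of_bound (measurable_setIntegral_kernel hm B).aestronglyMeasurable 1
    (Eventually.of_forall fun u => ?_)
  refine (norm_setIntegral_le_of_norm_le_const (C := 1) (measure_lt_top _ _)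
    fun v _ => hk u v).trans ?_
  rw [one_mul]
  exact measureReal_le_one

/-- Cutting `[0,1]` at the sign of the inner integral turns the left side into two rectangle
integrals, each at most the cut norm. -/
lemma setIntegral_abs_setIntegral_le (hm : Measurable (Function.uncurry k))
    (hk : ∀ u v, |k u v| ≤ 1) {B : Set unitInterval} (hB : MeasurableSet B) :
    ∫ u, |∫ v in B, k u v| ≤ 2 * cutNorm k := by
  set g : unitInterval → ℝ := fun u => ∫ v in B, k u v with hg
  have hgm : Measurable g := measurable_setIntegral_kernel hm B
  have hgi : Integrable g volume := integrable_setIntegral_kernel hm hk B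
  set A : Set unitInterval := {u | 0 ≤ g u} with hA
  have hAm : MeasurableSet A := measurableSet_le measurable_const hgm
  have hfub : ∀ C : Set unitInterval, ∫ z in C ×ˢ B, k z.1 z.2 = ∫ u in C, g u := fun C => by
    have := setIntegral_prod (μ := volume) (ν := volume) (s := C) (t := B)
      (fun z : unitInterval × unitInterval => k z.1 z.2) (integrable_kernel hm hk).integrableOn
    exact this
  have h1 : ∫ u in A, |g u| = ∫ u in A, g u :=
    setIntegral_congr_fun hAm fun u hu => abs_of_nonneg hu
  have h2 : ∫ u in Aᶜ, |g u| = -∫ u in Aᶜ, g u := by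
    rw [← integral_neg]
    exact setIntegral_congr_fun hAm.compl fun u hu => abs_of_neg (not_le.1 hu)
  rw [← integral_add_compl hAm hgi.abs, h1, h2, ← hfub, ← hfub]
  have h3 := abs_setIntegral_le_cutNorm hk hAm hB
  have h4 := abs_setIntegral_le_cutNorm hk hAm.compl hB
  linarith [le_abs_self (∫ z in A ×ˢ B, k z.1 z.2), neg_abs_le (∫ z in Aᶜ ×ˢ B, k z.1 z.2)]

end CutNorm

lemma Graphon.abs_sub_le_one (W W' : Graphon) (u v : unitInterval) : |W u v - W' u v| ≤ 1 := by
  rw [abs_le]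
  constructor <;> linarith [W.nonneg u v, W.le_one u v, W'.nonneg u v, W'.le_one u v]

/-- The difference is pointwise at most `1` in absolute value, so its square is at most its absolute
value and the `L¹` bound applies. -/
lemma norm_sq_op_sub_op_indicator_le (W W' : Graphon) {B : Set unitInterval} (hB : MeasurableSet B)
    (hμ : volume B ≠ ⊤) :
    ‖W.op (indicatorConstLp 2 hB hμ (1 : ℝ)) - W'.op (indicatorConstLp 2 hB hμ (1 : ℝ))‖ ^ 2
      ≤ 2 * cutNorm fun u v => W u v - W' u v := by
  set X : Signal := indicatorConstLp 2 hB hμ (1 : ℝ) with hX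
  have hk := W.abs_sub_le_one W'
  have hm : Measurable (Function.uncurry fun u v => W u v - W' u v) :=
    W.measurable.sub W'.measurable
  have hWX : ∀ (V : Graphon) (u : unitInterval), ∫ v, V u v * X v = ∫ v in B, V u v := by
    intro V u
    rw [← integral_indicator hB]
    refine integral_congr_ae ?_
    filter_upwards [indicatorConstLp_coeFn (p := 2) (hs := hB) (hμs := hμ) (c := (1 : ℝ))] with v hv
    rw [hX, hv]
    by_cases h : v ∈ B <;> simp [h]
  have hi : ∀ (V : Graphon) (u : unitInterval), Integrable (V u) (volume.restrict B) := fun V u =>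
    Integrable.of_bound (V.measurable.comp measurable_prodMk_left).aestronglyMeasurable 1
      (Eventually.of_forall fun v => by
        change ‖V u v‖ ≤ 1
        rw [Real.norm_of_nonneg (V.nonneg u v)]; exact V.le_one u v)
  have hF : ∀ᵐ u, (W.op X - W'.op X : Signal) u = ∫ v in B, (W u v - W' u v) := by
    filter_upwards [Lp.coeFn_sub (W.op X) (W'.op X), W.opFun_ae X, W'.opFun_ae X] with u h1 h2 h3
    rw [h1, Pi.sub_apply, W.op_apply, W'.op_apply, h2, h3, hWX, hWX, integral_sub (hi W u) (hi W' u)]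
  have hint := integrable_setIntegral_kernel hm hk B
  have hle : ∀ u, |∫ v in B, (W u v - W' u v)| ≤ 1 := fun u => by
    refine (norm_setIntegral_le_of_norm_le_const (f := fun v => W u v - W' u v) (C := 1)
      (measure_lt_top _ _) fun v _ => hk u v).trans ?_
    rw [one_mul]
    exact measureReal_le_one
  rw [norm_sq_eq_integral]
  refine le_trans ?_ (setIntegral_abs_setIntegral_le hm hk hB)
  refine integral_mono_ae (Lp.memLp (W.op X - W'.op X)).integrable_sq hint.abs ?_
  filter_upwards [hF] with u hu
  rw [hu, ← sq_abs, pow_two]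
  exact mul_le_of_le_one_left (abs_nonneg _) (hle u)

lemma Graphon.norm_op_apply_le (W : Graphon) (X : Signal) : ‖W.op X‖ ≤ ‖X‖ := by
  have h1 := W.op.le_opNorm X
  have h2 : ‖W.op‖ ≤ 1 := LinearMap.mkContinuous_norm_le _ zero_le_one _
  exact h1.trans (mul_le_of_le_one_left (norm_nonneg _) h2)

/-- Convergence in the cut norm implies strong convergence of the graphon operators. -/
lemma tendsto_op_apply {Wn : ℕ → Graphon} {W : Graphon}
    (hW : Tendsto (fun n => cutNorm fun u v => Wn n u v - W u v) atTop (𝓝 0)) (X : Signal) :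
    Tendsto (fun n => (Wn n).op X) atTop (𝓝 (W.op X)) := by
  have hind : ∀ (B : Set unitInterval) (hB : MeasurableSet B) (hμ : volume B ≠ ⊤),
      Tendsto (fun n => (Wn n).op (indicatorConstLp 2 hB hμ (1 : ℝ))) atTop
        (𝓝 (W.op (indicatorConstLp 2 hB hμ (1 : ℝ)))) := by
    intro B hB hμ
    rw [tendsto_iff_norm_sub_tendsto_zero]
    have h1 : Tendsto (fun n => ‖(Wn n).op (indicatorConstLp 2 hB hμ (1 : ℝ))
        - W.op (indicatorConstLp 2 hB hμ (1 : ℝ))‖ ^ 2) atTop (𝓝 0) :=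
      squeeze_zero (fun n => sq_nonneg _)
        (fun n => norm_sq_op_sub_op_indicator_le (Wn n) W hB hμ) (by simpa using hW.const_mul 2)
    have h2 := h1.sqrt
    simpa [Real.sqrt_sq (norm_nonneg _)] using h2
  refine Lp.induction (p := 2) (by norm_num)
    (motive := fun X : Signal => Tendsto (fun n => (Wn n).op X) atTop (𝓝 (W.op X))) ?_ ?_ ?_ X
  · intro c B hB hμ
    have h1 : ((Lp.simpleFunc.indicatorConst 2 hB hμ.ne c : Lp.simpleFunc ℝ 2 volume) : Signal)
        = c • indicatorConstLp 2 hB hμ.ne (1 : ℝ) := by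
      rw [Lp.simpleFunc.coe_indicatorConst]
      refine Lp.ext ?_
      filter_upwards [indicatorConstLp_coeFn (p := 2) (hs := hB) (hμs := hμ.ne) (c := c),
        indicatorConstLp_coeFn (p := 2) (hs := hB) (hμs := hμ.ne) (c := (1 : ℝ)),
        Lp.coeFn_smul c (indicatorConstLp 2 hB hμ.ne (1 : ℝ))] with v h1 h2 h3
      rw [h1, h3, Pi.smul_apply, h2]
      by_cases hv : v ∈ B <;> simp [hv]
    rw [h1]
    simp only [map_smul]
    exact (hind B hB hμ.ne).const_smul c
  · intro f g hf hg _ h1 h2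
    simp only [map_add]
    exact h1.add h2
  -- The set of good signals is closed because all the operators are contractions: an `ε / 3`
  -- argument.
  · refine isClosed_of_closure_subset fun Y hY => ?_
    rw [Set.mem_ofPred_eq, Metric.tendsto_atTop]
    intro ε hε
    obtain ⟨Z, hZ, hYZ⟩ := Metric.mem_closure_iff.1 hY (ε / 3) (by positivity)
    obtain ⟨n₀, hn₀⟩ := Metric.tendsto_atTop.1 hZ (ε / 3) (by positivity)
    refine ⟨n₀, fun n hn => ?_⟩
    rw [dist_eq_norm] at hYZ
    have h1 : dist ((Wn n).op Y) ((Wn n).op Z) < ε / 3 := by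
      rw [dist_eq_norm, ← map_sub]
      exact ((Wn n).norm_op_apply_le _).trans_lt hYZ
    have h2 : dist (W.op Z) (W.op Y) < ε / 3 := by
      rw [dist_comm, dist_eq_norm, ← map_sub]
      exact (W.norm_op_apply_le _).trans_lt hYZ
    calc dist ((Wn n).op Y) (W.op Y) ≤ _ := dist_triangle4 _ ((Wn n).op Z) (W.op Z) _
      _ < ε := by linarith [hn₀ n hn]

/-! ### Continuity of the network and of its weight derivatives. -/

section Limit

variable {Wn : ℕ → Graphon} {W : Graphon} {Yn : ℕ → Signal} {Y : Signal}

/-- The uniform bound `‖T_W‖ ≤ 1` lets the argument vary with `n` under mere strong convergence. -/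
lemma tendsto_op (hW : ∀ X, Tendsto (fun n => (Wn n).op X) atTop (𝓝 (W.op X)))
    (hY : Tendsto Yn atTop (𝓝 Y)) : Tendsto (fun n => (Wn n).op (Yn n)) atTop (𝓝 (W.op Y)) := by
  have h1 : Tendsto (fun n => (Wn n).op (Yn n - Y)) atTop (𝓝 0) :=
    squeeze_zero_norm (fun n => (Wn n).norm_op_apply_le _) (tendsto_iff_norm_sub_tendsto_zero.1 hY)
  have h2 := h1.add (hW Y)
  simpa [map_sub] using h2

lemma tendsto_op_pow (hW : ∀ X, Tendsto (fun n => (Wn n).op X) atTop (𝓝 (W.op X)))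
    (hY : Tendsto Yn atTop (𝓝 Y)) (k : ℕ) :
    Tendsto (fun n => ((Wn n).op ^ k) (Yn n)) atTop (𝓝 ((W.op ^ k) Y)) := by
  induction k with
  | zero => simpa using hY
  | succ k ih =>
    simp only [pow_succ', mul_apply_eq_comp]
    exact tendsto_op hW ih

lemma conv_apply (K : ℕ) (c : ℕ → ℝ) (W : Graphon) (X : Signal) :
    conv K c W X = ∑ k ∈ Finset.range K, c k • (W.op ^ k) X := by
  simp [conv]

lemma tendsto_conv (hW : ∀ X, Tendsto (fun n => (Wn n).op X) atTop (𝓝 (W.op X)))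
    (hY : Tendsto Yn atTop (𝓝 Y)) (K : ℕ) (c : ℕ → ℝ) :
    Tendsto (fun n => conv K c (Wn n) (Yn n)) atTop (𝓝 (conv K c W Y)) := by
  simp only [conv_apply]
  exact tendsto_finsetSum _ fun k _ => (tendsto_op_pow hW hY k).const_smul (c k)

variable {σ : ℝ → ℝ} (hσ : LipschitzWith 1 σ)

lemma tendsto_activation (hY : Tendsto Yn atTop (𝓝 Y)) :
    Tendsto (fun n => activation hσ (Yn n)) atTop (𝓝 (activation hσ Y)) := by
  rw [tendsto_iff_norm_sub_tendsto_zero] at hY ⊢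
  exact squeeze_zero (fun n => norm_nonneg _) (fun n => norm_activation_sub_le hσ _ _) hY

lemma norm_deriv_le_one (hσ : LipschitzWith 1 σ) (t : ℝ) : |deriv σ t| ≤ 1 := by
  simpa using norm_deriv_le_of_lipschitz hσ (x₀ := t)

lemma derivMul_ae (U V : Signal) : ∀ᵐ u, derivMul hσ U V u = deriv σ (U u) * V u :=
  (memLp_deriv_mul hσ U V).coeFn_toLp

lemma norm_derivMul_sub_le (U V V' : Signal) :
    ‖derivMul hσ U V - derivMul hσ U V'‖ ≤ ‖V - V'‖ := by
  refine Lp.norm_le_norm_of_ae_le ?_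
  filter_upwards [Lp.coeFn_sub (derivMul hσ U V) (derivMul hσ U V'), Lp.coeFn_sub V V',
    derivMul_ae hσ U V, derivMul_ae hσ U V'] with u h1 h2 h3 h4
  rw [h1, h2, Pi.sub_apply, Pi.sub_apply, h3, h4, ← mul_sub, norm_mul]
  exact mul_le_of_le_one_left (norm_nonneg _) (norm_deriv_le_one hσ _)

/-- Every subsequence of `Un` has a further one converging almost everywhere; along it `σ'`
converges at almost every point by continuity there. Since `|σ'| ≤ 1`, the squared difference is
dominated by `4 * V ^ 2`, which needs `V` to be fixed. -/
lemma tendsto_derivMul_left {Un : ℕ → Signal} {U : Signal} (hU : Tendsto Un atTop (𝓝 U))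
    (hc : ∀ᵐ u, ContinuousAt (deriv σ) (U u)) (V : Signal) :
    Tendsto (fun n => derivMul hσ (Un n) V) atTop (𝓝 (derivMul hσ U V)) := by
  refine tendsto_of_subseq_tendsto fun ns hns => ?_
  obtain ⟨ms, -, hms⟩ := (tendstoInMeasure_of_tendsto_Lp (hU.comp hns)).exists_seq_tendsto_ae
  refine ⟨ms, ?_⟩
  rw [tendsto_iff_norm_sub_tendsto_zero]
  set F : ℕ → Signal := fun n => derivMul hσ (Un (ns (ms n))) V - derivMul hσ U V with hF
  have hae : ∀ n, ∀ᵐ u, F n u = (deriv σ (Un (ns (ms n)) u) - deriv σ (U u)) * V u := fun n => by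
    filter_upwards [Lp.coeFn_sub (derivMul hσ (Un (ns (ms n))) V) (derivMul hσ U V),
      derivMul_ae hσ (Un (ns (ms n))) V, derivMul_ae hσ U V] with u h1 h2 h3
    rw [hF, h1, Pi.sub_apply, h2, h3, sub_mul]
  have hlim : Tendsto (fun n => ∫ u, F n u ^ 2) atTop (𝓝 (∫ _ : unitInterval, (0 : ℝ))) := by
    refine tendsto_integral_of_dominated_convergence (fun u => 4 * V u ^ 2)
      (fun n => (Lp.aestronglyMeasurable (F n)).pow 2)
      ((Lp.memLp V).integrable_sq.const_mul 4) (fun n => ?_) ?_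
    · filter_upwards [hae n] with u hu
      rw [hu, Real.norm_of_nonneg (sq_nonneg _), mul_pow]
      refine mul_le_mul_of_nonneg_right ?_ (sq_nonneg _)
      have h1 := abs_le.1 (norm_deriv_le_one hσ (Un (ns (ms n)) u))
      have h2 := abs_le.1 (norm_deriv_le_one hσ (U u))
      nlinarith
    · filter_upwards [hms, hc, ae_all_iff.2 hae] with u h1 h2 h3
      have h4 := (h2.tendsto.comp h1).sub_const (deriv σ (U u))
      have h5 := (h4.mul_const (V u)).pow 2
      rw [sub_self, zero_mul, zero_pow two_ne_zero] at h5
      exact h5.congr fun n => by rw [h3 n]; rfl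
  simp only [← norm_sq_eq_integral, integral_zero] at hlim
  have h6 := hlim.sqrt
  simpa [Real.sqrt_sq (norm_nonneg _)] using h6

lemma tendsto_derivMul {Un : ℕ → Signal} {U : Signal} (hU : Tendsto Un atTop (𝓝 U))
    (hc : ∀ᵐ u, ContinuousAt (deriv σ) (U u)) (hY : Tendsto Yn atTop (𝓝 Y)) :
    Tendsto (fun n => derivMul hσ (Un n) (Yn n)) atTop (𝓝 (derivMul hσ U Y)) := by
  have h1 : Tendsto (fun n => derivMul hσ (Un n) (Yn n) - derivMul hσ (Un n) Y) atTop (𝓝 0) :=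
    squeeze_zero_norm (fun n => norm_derivMul_sub_le hσ _ _ _)
      (tendsto_iff_norm_sub_tendsto_zero.1 hY)
  simpa using h1.add (tendsto_derivMul_left hσ hU hc Y)

lemma tendsto_layer (hW : ∀ X, Tendsto (fun n => (Wn n).op X) atTop (𝓝 (W.op X)))
    (hY : Tendsto Yn atTop (𝓝 Y)) (K : ℕ) (h : ℕ → ℕ → ℝ) (l : ℕ) :
    Tendsto (fun n => layer hσ K h (Wn n) (Yn n) l) atTop (𝓝 (layer hσ K h W Y l)) := by
  induction l with
  | zero => exact hY
  | succ l ih => exact tendsto_activation hσ (tendsto_conv hW ih K _)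

lemma tendsto_preact (hW : ∀ X, Tendsto (fun n => (Wn n).op X) atTop (𝓝 (W.op X)))
    (hY : Tendsto Yn atTop (𝓝 Y)) (K : ℕ) (h : ℕ → ℕ → ℝ) (l : ℕ) :
    Tendsto (fun n => preact hσ K h (Wn n) (Yn n) l) atTop (𝓝 (preact hσ K h W Y l)) :=
  tendsto_conv hW (tendsto_layer hσ hW hY K h (l - 1)) K _

/-- The weight derivatives of the network depend continuously on the graphon and the signal. -/
lemma tendsto_layerDeriv (hW : ∀ X, Tendsto (fun n => (Wn n).op X) atTop (𝓝 (W.op X)))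
    (hY : Tendsto Yn atTop (𝓝 Y)) (K : ℕ) (h : ℕ → ℕ → ℝ) (l k m : ℕ)
    (hreg : ∀ j ∈ Finset.Icc 1 m, ∀ᵐ u, ContinuousAt (deriv σ) (preact hσ K h W Y j u)) :
    Tendsto (fun n => layerDeriv hσ K h (Wn n) (Yn n) l k m) atTop
      (𝓝 (layerDeriv hσ K h W Y l k m)) := by
  induction m with
  | zero => exact tendsto_const_nhds
  | succ m ih =>
    have ih' := ih fun j hj => hreg j (Finset.mem_Icc.2
      ⟨(Finset.mem_Icc.1 hj).1, (Finset.mem_Icc.1 hj).2.trans (Nat.le_succ m)⟩)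
    refine tendsto_derivMul hσ (tendsto_preact hσ hW hY K h (m + 1))
      (hreg (m + 1) (Finset.mem_Icc.2 ⟨by omega, le_rfl⟩)) ?_
    by_cases hl : m + 1 = l
    · simp only [if_pos hl]
      exact tendsto_op_pow hW (tendsto_layer hσ hW hY K h m) k
    · simp only [if_neg hl]
      exact tendsto_conv hW ih' K _

end Limit

/-! ### Step functions on the cells. -/

section Step

variable {n : ℕ}

lemma exists_mem_cell (hn : 0 < n) (u : unitInterval) : ∃ i, u ∈ cell n i := by
  have hn' : (0 : ℝ) < n := by exact_mod_cast hn
  have hu0 : 0 ≤ (u : ℝ) * n := mul_nonneg u.2.1 hn'.le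
  by_cases h : ⌊(u : ℝ) * n⌋₊ < n
  · refine ⟨⟨_, h⟩, ?_, Or.inl ?_⟩
    · rw [div_le_iff₀ hn']; exact Nat.floor_le hu0
    · rw [lt_div_iff₀ hn']; exact Nat.lt_floor_add_one _
  -- Only `u = 1` arrives here, and the last cell is closed on the right.
  · refine ⟨⟨n - 1, by omega⟩, ?_, Or.inr (by simp; omega)⟩
    have h1 : (n : ℝ) ≤ (u : ℝ) * n := (Nat.cast_le.2 (not_lt.1 h)).trans (Nat.floor_le hu0)
    rw [div_le_iff₀ hn']
    refine le_trans ?_ h1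
    exact_mod_cast Nat.sub_le n 1

lemma volume_real_cell (i : Fin n) : (volume : Measure unitInterval).real (cell n i) = 1 / n := by
  have hn : (0 : ℝ) < n := by exact_mod_cast (Fin.pos i)
  have hi1 : ((i : ℕ) : ℝ) + 1 ≤ n := by exact_mod_cast i.2
  have ha : ((i : ℕ) : ℝ) / n ∈ unitInterval :=
    ⟨by positivity, by rw [div_le_one hn]; linarith⟩
  have hb : (((i : ℕ) : ℝ) + 1) / n ∈ unitInterval :=
    ⟨by positivity, by rw [div_le_one hn]; exact hi1⟩
  have hlen : (((i : ℕ) : ℝ) + 1) / n - ((i : ℕ) : ℝ) / n = 1 / n := by ring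
  have hpos : (0 : ℝ) ≤ 1 / n := by positivity
  by_cases hlast : (i : ℕ) + 1 = n
  · have : cell n i = Set.Icc ⟨_, ha⟩ ⟨_, hb⟩ := by
      ext u
      have h1 : (((i : ℕ) : ℝ) + 1) / n = 1 := by
        rw [div_eq_one_iff_eq hn.ne']; exact_mod_cast hlast
      constructor
      · rintro ⟨h, -⟩
        exact ⟨h, Subtype.coe_le_coe.1 (u.2.2.trans h1.ge)⟩
      · rintro ⟨h, -⟩
        exact ⟨h, Or.inr hlast⟩
    rw [this, measureReal_def, unitInterval.volume_Icc, hlen, ENNReal.toReal_ofReal hpos]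
  · have : cell n i = Set.Ico ⟨_, ha⟩ ⟨_, hb⟩ := by
      ext u
      constructor
      · rintro ⟨h, h' | h'⟩
        · exact ⟨h, h'⟩
        · exact absurd h' hlast
      · rintro ⟨h, h'⟩
        exact ⟨h, Or.inl h'⟩
    rw [this, measureReal_def, unitInterval.volume_Ico, hlen, ENNReal.toReal_ofReal hpos]

open Classical in
lemma sum_ite_cell {u : unitInterval} {i : Fin n} (hu : u ∈ cell n i) (y : Fin n → ℝ) :
    ∑ j, (if u ∈ cell n j then y j else 0) = y i := by
  rw [Finset.sum_eq_single i, if_pos hu]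
  · intro j _ hj
    exact if_neg fun h => hj (cell_disjoint h hu)
  · simp

open Classical in
lemma integral_sum_ite_cell (y : Fin n → ℝ) :
    ∫ u, ∑ j, (if u ∈ cell n j then y j else 0) = (∑ j, y j) / n := by
  have h1 : ∀ j, (fun u : unitInterval => if u ∈ cell n j then y j else 0)
      = (cell n j).indicator fun _ => y j := fun j => by
    ext u
    simp [Set.indicator_apply]
  rw [integral_finsetSum]
  · rw [Finset.sum_div]
    refine Finset.sum_congr rfl fun j _ => ?_
    rw [h1, integral_indicator_const _ (measurableSet_cell n j), volume_real_cell, smul_eq_mul]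
    ring
  · intro j _
    rw [h1]
    exact (integrable_const _).indicator (measurableSet_cell n j)

lemma inducedSignal_ae (y : Fin n → ℝ) :
    ∀ᵐ u, ∀ i, u ∈ cell n i → inducedSignal y u = y i := by
  classical
  filter_upwards [(memLp_inducedSignal y).coeFn_toLp] with u hu i hi
  rw [inducedSignal, hu]
  convert sum_ite_cell hi y

/-- For `n > 0` the cells cover `[0,1]`; for `n = 0` the hypothesis would be vacuous. This criterion
reduces each network operation on induced signals to an operation on vectors. -/
lemma eq_inducedSignal (hn : 0 < n) {Y : Signal} {y : Fin n → ℝ}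
    (h : ∀ᵐ u, ∀ i, u ∈ cell n i → Y u = y i) : Y = inducedSignal y := by
  refine Lp.ext ?_
  filter_upwards [h, inducedSignal_ae y] with u h1 h2
  obtain ⟨i, hi⟩ := exists_mem_cell hn u
  rw [h1 i hi, h2 i hi]

lemma inner_inducedSignal (hn : 0 < n) (y z : Fin n → ℝ) :
    inner ℝ (inducedSignal y) (inducedSignal z) = (∑ i, y i * z i) / n := by
  classical
  rw [← integral_sum_ite_cell, L2.inner_def]
  refine integral_congr_ae ?_
  filter_upwards [inducedSignal_ae y, inducedSignal_ae z] with u h1 h2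
  obtain ⟨i, hi⟩ := exists_mem_cell hn u
  rw [sum_ite_cell hi fun i => y i * z i, h1 i hi, h2 i hi]
  simp [mul_comm]

lemma inducedGraphon_apply (G : WGraph n) {u v : unitInterval} {i j : Fin n} (hu : u ∈ cell n i)
    (hv : v ∈ cell n j) : G.inducedGraphon u v = G.w i j := by
  classical
  change ∑ i, ∑ j, (if u ∈ cell n i ∧ v ∈ cell n j then G.w i j else 0) = G.w i j
  rw [← sum_ite_cell hv fun j => G.w i j,
    ← sum_ite_cell hu fun i => ∑ j, if v ∈ cell n j then G.w i j else 0]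
  refine Finset.sum_congr rfl fun i _ => ?_
  by_cases h : u ∈ cell n i <;> simp [h]

lemma op_inducedSignal (hn : 0 < n) (G : WGraph n) (y : Fin n → ℝ) :
    G.inducedGraphon.op (inducedSignal y)
      = inducedSignal fun i => (∑ j, G.w i j * y j) / n := by
  classical
  refine eq_inducedSignal hn ?_
  filter_upwards [G.inducedGraphon.opFun_ae (inducedSignal y)] with u hu i hi
  rw [Graphon.op_apply, hu, ← integral_sum_ite_cell]
  refine integral_congr_ae ?_
  filter_upwards [inducedSignal_ae y] with v hv
  obtain ⟨j, hj⟩ := exists_mem_cell hn v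
  rw [sum_ite_cell hj fun j => G.w i j * y j, hv j hj, inducedGraphon_apply G hi hj]

/-! ### Equivariance of the network under relabelling. -/

/-- `Y` and `Y'` are induced by a graph signal and by its relabelling. -/
def IsRelabelling (π : Equiv.Perm (Fin n)) (Y Y' : Signal) : Prop :=
  ∃ y : Fin n → ℝ, Y = inducedSignal y ∧ Y' = inducedSignal (y ∘ π)

namespace IsRelabelling

variable {π : Equiv.Perm (Fin n)} {Y Y' Z Z' : Signal}

lemma zero (hn : 0 < n) : IsRelabelling π 0 0 := by
  have h : ∀ᵐ u : unitInterval, ∀ i, u ∈ cell n i → (0 : Signal) u = (0 : Fin n → ℝ) i := by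
    filter_upwards [Lp.coeFn_zero ℝ 2 (volume : Measure unitInterval)] with u hu i _
    rw [hu]; rfl
  exact ⟨0, eq_inducedSignal hn h, eq_inducedSignal hn h⟩

lemma add (hn : 0 < n) (hY : IsRelabelling π Y Y') (hZ : IsRelabelling π Z Z') :
    IsRelabelling π (Y + Z) (Y' + Z') := by
  obtain ⟨y, rfl, rfl⟩ := hY
  obtain ⟨z, rfl, rfl⟩ := hZ
  have h : ∀ y z : Fin n → ℝ, inducedSignal y + inducedSignal z = inducedSignal (y + z) :=
    fun y z => eq_inducedSignal hn (by
      filter_upwards [Lp.coeFn_add (inducedSignal y) (inducedSignal z), inducedSignal_ae y,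
        inducedSignal_ae z] with u h1 h2 h3 i hi
      rw [h1, Pi.add_apply, Pi.add_apply, h2 i hi, h3 i hi])
  exact ⟨y + z, h _ _, h _ _⟩

lemma smul (hn : 0 < n) (hY : IsRelabelling π Y Y') (c : ℝ) :
    IsRelabelling π (c • Y) (c • Y') := by
  obtain ⟨y, rfl, rfl⟩ := hY
  have h : ∀ y : Fin n → ℝ, c • inducedSignal y = inducedSignal (c • y) :=
    fun y => eq_inducedSignal hn (by
      filter_upwards [Lp.coeFn_smul c (inducedSignal y), inducedSignal_ae y] with u h1 h2 i hi
      rw [h1, Pi.smul_apply, Pi.smul_apply, h2 i hi])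
  exact ⟨c • y, h _, h _⟩

/-- The permutation acts on both indices of the weights and on the signal; reindexing the inner sum
by `π` leaves it only on the outer index. -/
lemma op (hn : 0 < n) (hY : IsRelabelling π Y Y') (G : WGraph n) :
    IsRelabelling π (G.inducedGraphon.op Y) ((G.relabel π).inducedGraphon.op Y') := by
  obtain ⟨y, rfl, rfl⟩ := hY
  refine ⟨_, op_inducedSignal hn G y, ?_⟩
  rw [op_inducedSignal hn]
  congr 1
  funext i
  simp only [WGraph.relabel, Function.comp_apply]
  rw [Equiv.sum_comp π fun j => G.w (π i) j * y j]

lemma op_pow (hn : 0 < n) (hY : IsRelabelling π Y Y') (G : WGraph n) (k : ℕ) :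
    IsRelabelling π ((G.inducedGraphon.op ^ k) Y) (((G.relabel π).inducedGraphon.op ^ k) Y') := by
  induction k with
  | zero => simpa using hY
  | succ k ih =>
    simp only [pow_succ', mul_apply_eq_comp]
    exact ih.op hn G

lemma sum (hn : 0 < n) {ι : Type*} (s : Finset ι) {f f' : ι → Signal}
    (h : ∀ a ∈ s, IsRelabelling π (f a) (f' a)) : IsRelabelling π (∑ a ∈ s, f a) (∑ a ∈ s, f' a) := by
  classical
  induction s using Finset.induction_on with
  | empty => simpa using zero hn
  | insert a s ha ih =>
    rw [Finset.sum_insert ha, Finset.sum_insert ha]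
    exact (h a (Finset.mem_insert_self _ _)).add hn
      (ih fun b hb => h b (Finset.mem_insert_of_mem hb))

lemma conv (hn : 0 < n) (hY : IsRelabelling π Y Y') (G : WGraph n) (K : ℕ) (c : ℕ → ℝ) :
    IsRelabelling π (conv K c G.inducedGraphon Y) (GNTK.conv K c (G.relabel π).inducedGraphon Y') := by
  rw [conv_apply, conv_apply]
  exact sum hn _ fun k _ => (hY.op_pow hn G k).smul hn (c k)

variable {σ : ℝ → ℝ} (hσ : LipschitzWith 1 σ)

lemma activation (hn : 0 < n) (hY : IsRelabelling π Y Y') :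
    IsRelabelling π (activation hσ Y) (GNTK.activation hσ Y') := by
  obtain ⟨y, rfl, rfl⟩ := hY
  have h : ∀ y : Fin n → ℝ, GNTK.activation hσ (inducedSignal y) = inducedSignal (σ ∘ y) :=
    fun y => eq_inducedSignal hn (by
      filter_upwards [(memLp_activation hσ (inducedSignal y)).coeFn_toLp, inducedSignal_ae y]
        with u h1 h2 i hi
      rw [GNTK.activation, h1, h2 i hi, Function.comp_apply])
  exact ⟨σ ∘ y, h _, h _⟩

lemma derivMul (hn : 0 < n) (hY : IsRelabelling π Y Y') (hZ : IsRelabelling π Z Z') :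
    IsRelabelling π (derivMul hσ Y Z) (GNTK.derivMul hσ Y' Z') := by
  obtain ⟨y, rfl, rfl⟩ := hY
  obtain ⟨z, rfl, rfl⟩ := hZ
  have h : ∀ y z : Fin n → ℝ, GNTK.derivMul hσ (inducedSignal y) (inducedSignal z)
      = inducedSignal fun i => deriv σ (y i) * z i :=
    fun y z => eq_inducedSignal hn (by
      filter_upwards [derivMul_ae hσ (inducedSignal y) (inducedSignal z), inducedSignal_ae y,
        inducedSignal_ae z] with u h1 h2 h3 i hi
      rw [h1, h2 i hi, h3 i hi])
  exact ⟨_, h _ _, h _ _⟩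

lemma layer (hn : 0 < n) (hY : IsRelabelling π Y Y') (G : WGraph n) (K : ℕ) (h : ℕ → ℕ → ℝ)
    (l : ℕ) : IsRelabelling π (layer hσ K h G.inducedGraphon Y l)
      (GNTK.layer hσ K h (G.relabel π).inducedGraphon Y' l) := by
  induction l with
  | zero => exact hY
  | succ l ih => exact (ih.conv hn G K _).activation hσ hn

lemma layerDeriv (hn : 0 < n) (hY : IsRelabelling π Y Y') (G : WGraph n) (K : ℕ) (h : ℕ → ℕ → ℝ)
    (l k m : ℕ) : IsRelabelling π (layerDeriv hσ K h G.inducedGraphon Y l k m)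
      (GNTK.layerDeriv hσ K h (G.relabel π).inducedGraphon Y' l k m) := by
  induction m with
  | zero => exact zero hn
  | succ m ih =>
    refine derivMul hσ hn ((hY.layer hσ hn G K h m).conv hn G K _) ?_
    by_cases hl : m + 1 = l
    · simp only [if_pos hl]
      exact (hY.layer hσ hn G K h m).op_pow hn G k
    · simp only [if_neg hl]
      exact ih.conv hn G K _

lemma inner_eq (hn : 0 < n) (hY : IsRelabelling π Y Y') (hZ : IsRelabelling π Z Z') :
    inner ℝ Y Z = inner ℝ Y' Z' := by
  obtain ⟨y, rfl, rfl⟩ := hY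
  obtain ⟨z, rfl, rfl⟩ := hZ
  rw [inner_inducedSignal hn, inner_inducedSignal hn]
  congr 1
  exact (Equiv.sum_comp π fun i => y i * z i).symm

end IsRelabelling

end Step

/-! ### The kernel matrix as a finite sum of rank-one operators. -/

section Kernel

variable {σ : ℝ → ℝ} (hσ : LipschitzWith 1 σ) (L K : ℕ) (h : ℕ → ℕ → ℝ)

/-- The derivatives, in the weight `h a.1 a.2`, of the network outputs for all the signals. -/
def outputDeriv (W : Graphon) {M : ℕ} (X : Fin M → Signal) (a : ℕ × ℕ) : Signals M :=
  WithLp.toLp 2 fun i => layerDeriv hσ K h W (X i) a.1 a.2 L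

/-- The `(i, j)` block of `v ⊗ v` on the product space is `v i ⊗ v j`; exchanging the sum over
signals with the sum over weights does the rest. -/
lemma ntkMatrix_eq_sum (W : Graphon) {M : ℕ} (X : Fin M → Signal) :
    ntkMatrix hσ L K h W X = ∑ a ∈ Finset.Icc 1 L ×ˢ Finset.range K,
      InnerProductSpace.rankOne ℝ (outputDeriv hσ L K h W X a) (outputDeriv hσ L K h W X a) := by
  ext1 Y
  apply PiLp.ext
  intro i
  have h1 : (ntkMatrix hσ L K h W X Y) i = ∑ j, wntk hσ L K h W (X i) (X j) (Y j) := by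
    simp [ntkMatrix, blockOp]
  have h2 : ∀ s : Finset (ℕ × ℕ), ∀ f : ℕ × ℕ → Signals M, (∑ a ∈ s, f a) i = ∑ a ∈ s, f a i :=
    fun s f => by simp
  rw [h1, sum_apply, h2]
  simp only [wntk, sum_apply, InnerProductSpace.rankOne_apply, PiLp.smul_apply]
  simp only [PiLp.inner_apply, outputDeriv, Finset.sum_smul, Finset.sum_product]
  rw [Finset.sum_comm]
  refine Finset.sum_congr rfl fun l _ => ?_
  rw [Finset.sum_comm]

lemma isCompactOperator_ntkMatrix (W : Graphon) {M : ℕ} (X : Fin M → Signal) :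
    IsCompactOperator (ntkMatrix hσ L K h W X) := by
  rw [ntkMatrix_eq_sum]
  exact isCompactOperator_sum_rankOne _ _

lemma isSelfAdjoint_ntkMatrix (W : Graphon) {M : ℕ} (X : Fin M → Signal) :
    IsSelfAdjoint (ntkMatrix hσ L K h W X) := by
  rw [ntkMatrix_eq_sum, ContinuousLinearMap.isSelfAdjoint_iff_isSymmetric]
  exact isSymmetric_sum_rankOne _ _

lemma exists_posDiag_ntkMatrix (W : Graphon) {M : ℕ} (X : Fin M → Signal) :
    ∃ (N : ℕ) (e : Fin N → Signals M) (l : Fin N → ℝ), PosDiag (ntkMatrix hσ L K h W X) e l := by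
  rw [ntkMatrix_eq_sum]
  exact exists_posDiag_sum_rankOne _ _

lemma eig_ntkMatrix_relabel {n : ℕ} (G : WGraph n) (π : Equiv.Perm (Fin n)) {M : ℕ}
    (x : Fin M → Fin n → ℝ) {p : ℤ} (hp : p ≠ 0) :
    eig (ntkMatrix hσ L K h (G.relabel π).inducedGraphon fun i => inducedSignal (x i ∘ π)) p
      = eig (ntkMatrix hσ L K h G.inducedGraphon fun i => inducedSignal (x i)) p := by
  obtain ⟨N, e, l, hd⟩ := exists_posDiag_ntkMatrix hσ L K h G.inducedGraphon
    fun i => inducedSignal (x i)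
  obtain ⟨N', e', l', hd'⟩ := exists_posDiag_ntkMatrix hσ L K h (G.relabel π).inducedGraphon
    fun i => inducedSignal (x i ∘ π)
  -- Without nodes there are no cells, but the only permutation is the identity and both sides
  -- coincide.
  rcases Nat.eq_zero_or_pos n with rfl | hn
  · obtain rfl : π = 1 := Subsingleton.elim _ _
    rfl
  rcases lt_or_gt_of_ne hp with hp | hp
  · rw [hd.eig_of_neg hp, hd'.eig_of_neg hp]
  lift p to ℕ using hp.le
  have hp1 : 1 ≤ p := by omega
  rw [PosDiag.eig_eq_posEig _ hp1, PosDiag.eig_eq_posEig _ hp1]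
  refine (posEig_eq_of_gram_eq (fun a _ b _ => ?_) (ntkMatrix_eq_sum hσ L K h _ _)
    (ntkMatrix_eq_sum hσ L K h _ _) hd hd' hp1).symm
  simp only [outputDeriv, PiLp.inner_apply]
  refine Finset.sum_congr rfl fun i _ => ?_
  have hx : IsRelabelling π (inducedSignal (x i)) (inducedSignal (x i ∘ π)) := ⟨x i, rfl, rfl⟩
  exact (hx.layerDeriv hσ hn G K h _ _ _).inner_eq hn (hx.layerDeriv hσ hn G K h _ _ _)

lemma tendsto_ntkMatrix {Wn : ℕ → Graphon} {W : Graphon}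
    (hW : ∀ X, Tendsto (fun n => (Wn n).op X) atTop (𝓝 (W.op X))) {M : ℕ}
    {Xn : ℕ → Fin M → Signal} {X : Fin M → Signal}
    (hX : ∀ i, Tendsto (fun n => Xn n i) atTop (𝓝 (X i)))
    (hreg : ∀ i, ∀ j ∈ Finset.Icc 1 L,
      ∀ᵐ u, ContinuousAt (deriv σ) (preact hσ K h W (X i) j u)) :
    Tendsto (fun n => ntkMatrix hσ L K h (Wn n) (Xn n)) atTop (𝓝 (ntkMatrix hσ L K h W X)) := by
  simp only [ntkMatrix_eq_sum]
  refine tendsto_finsetSum _ fun a _ => ?_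
  have h1 : Tendsto (fun n => outputDeriv hσ L K h (Wn n) (Xn n) a) atTop
      (𝓝 (outputDeriv hσ L K h W X a)) := by
    refine ((PiLp.continuous_toLp 2 fun _ : Fin M => Signal).tendsto _).comp (tendsto_pi_nhds.2 ?_)
    exact fun i => tendsto_layerDeriv hσ hW (hX i) K h _ _ _ (hreg i)
  -- Continuity into the operator norm: this turns norm convergence of the finitely many derivative
  -- vectors into norm convergence of the kernels.
  have h2 : Continuous fun v : Signals M => InnerProductSpace.rankOne ℝ v v :=
    (InnerProductSpace.rankOne ℝ (E := Signals M) (F := Signals M)).continuous.clm_apply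
      continuous_id
  exact (h2.tendsto _).comp h1

end Kernel

end GNTK

end

open GNTK
theorem theorem2
    -- the architecture: `L` layers, filters of order `K`, activation `σ`, weights `h l k`
    (L K : ℕ) (σ : ℝ → ℝ) (hσ : LipschitzWith 1 σ) (h : ℕ → ℕ → ℝ)
    -- `M` signals on each graph `G_n`, and the limit objects
    (M : ℕ) (G : ∀ n, WGraph n) (x : ∀ n, Fin M → Fin n → ℝ)
    (W : Graphon) (X : Fin M → Signal)
    -- `G_n → W`, and `(G_n, x_{i,n}) → (W, X_i)` up to the relabellings `π_n` of the nodes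
    (π : ∀ n, Equiv.Perm (Fin n))
    (hG : GraphsConverge G W)
    (hW : Tendsto
      (fun n => cutNorm fun u v => ((G n).relabel (π n)).inducedGraphon u v - W u v) atTop (𝓝 0))
    (hX : ∀ i, Tendsto (fun n => ‖inducedSignal (x n i ∘ π n) - X i‖) atTop (𝓝 0))
    -- the derivative `σ'` exists and is continuous at almost all pre-activations of the limit network
    (hreg : ∀ i, ∀ l ∈ Finset.Icc 1 L, ∀ᵐ u,
      DifferentiableAt ℝ σ (preact hσ K h W (X i) l u) ∧
        ContinuousAt (deriv σ) (preact hσ K h W (X i) l u))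
    -- the matrix operators: of the graphs, of the relabelled graphs, and of the limit
    (Θn Θnπ : ℕ → (Signals M →L[ℝ] Signals M)) (Θ : Signals M →L[ℝ] Signals M)
    (hΘn : ∀ n, Θn n =
      ntkMatrix hσ L K h (G n).inducedGraphon fun i => inducedSignal (x n i))
    (hΘnπ : ∀ n, Θnπ n =
      ntkMatrix hσ L K h ((G n).relabel (π n)).inducedGraphon fun i => inducedSignal (x n i ∘ π n))
    (hΘ : Θ = ntkMatrix hσ L K h W X) :
    -- all the operators are compact and self-adjoint
    (∀ n, IsCompactOperator (Θn n) ∧ IsSelfAdjoint (Θn n)) ∧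
    (∀ n, IsCompactOperator (Θnπ n) ∧ IsSelfAdjoint (Θnπ n)) ∧
    (IsCompactOperator Θ ∧ IsSelfAdjoint Θ) ∧
    -- the ordered eigenvalues converge, and do not depend on the labelling
    (∀ p : ℤ, p ≠ 0 →
      Tendsto (fun n => |eig (Θn n) p - eig Θ p|) atTop (𝓝 0) ∧
      ∀ n, eig (Θnπ n) p = eig (Θn n) p) ∧
    -- the spectral projectors converge in the operator norm
    (∀ p : ℤ, p ≠ 0 → eig Θ p ≠ 0 →
      Tendsto
        (fun n => spectralProj (Θnπ n) (eig (Θnπ n) '' {q | q ≠ 0 ∧ eig Θ q = eig Θ p}))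
        atTop (𝓝 (spectralProj Θ {eig Θ p}))) := by

  obtain rfl : Θn = _ := funext hΘn
  obtain rfl : Θnπ = _ := funext hΘnπ
  subst hΘ
  have hlim : Tendsto (fun n => ntkMatrix hσ L K h ((G n).relabel (π n)).inducedGraphon
      fun i => inducedSignal (x n i ∘ π n)) atTop (𝓝 (ntkMatrix hσ L K h W X)) :=
    tendsto_ntkMatrix hσ L K h (tendsto_op_apply hW)
      (fun i => tendsto_iff_norm_sub_tendsto_zero.2 (hX i))
      fun i j hj => (hreg i j hj).mono fun u hu => hu.2
  obtain ⟨N, e, l, hd⟩ := exists_posDiag_ntkMatrix hσ L K h W X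
  have hdn : ∀ n, ∃ (N' : ℕ) (e' : Fin N' → Signals M) (l' : Fin N' → ℝ),
      PosDiag (ntkMatrix hσ L K h ((G n).relabel (π n)).inducedGraphon
        fun i => inducedSignal (x n i ∘ π n)) e' l' := fun n =>
    exists_posDiag_ntkMatrix hσ L K h _ _
  refine ⟨fun n => ⟨isCompactOperator_ntkMatrix hσ L K h _ _, isSelfAdjoint_ntkMatrix hσ L K h _ _⟩,
    fun n => ⟨isCompactOperator_ntkMatrix hσ L K h _ _, isSelfAdjoint_ntkMatrix hσ L K h _ _⟩,
    ⟨isCompactOperator_ntkMatrix hσ L K h _ _, isSelfAdjoint_ntkMatrix hσ L K h _ _⟩,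
    fun p hp => ⟨?_, fun n => eig_ntkMatrix_relabel hσ L K h (G n) (π n) (x n) hp⟩,
    fun p hp h0 => hd.tendsto_spectralProj hdn hlim hp h0⟩
  -- Only the relabelled kernels converge in norm to the limit; their eigenvalue limit is
  -- transferred to the original labelling by invariance.
  refine (hd.tendsto_eig hdn hlim hp).congr fun n => ?_
  rw [eig_ntkMatrix_relabel hσ L K h (G n) (π n) (x n) hp]
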